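/- Consider first-order logic with equality over relation symbols of arity at least $1$ (countably many of each arity), countably many constant symbols, and no function symbols of positive arity; the logical symbols are $=,\bot,\top,\neg,\wedge,\vee,\rightarrow,\leftrightarrow,\forall,\exists$, and domains of structures are non-empty. The Guarded Fragment $\mathrm{GF}$ is the least set of formulas that contains every atomic formula (relational atoms and equalities), is closed under Boolean connectives (including the constants $\top,\bot$), and contains $\exists\bar x\,(\gamma\wedge\psi)$ and $\forall\bar x\,(\gamma\rightarrow\psi)$ whenever $\bar x$ is a finite tuple of variables, $\psi\in\mathrm{GF}$, $\gamma$ is an atomic formula, and every variable of $\bar x$ and every free variable of $\psi$ occurs in $\gamma$; here $\exists\bar x$ and $\forall\bar x$ abbreviate iterated quantification. A $\mathrm{GF}$-sentence is a formula of $\mathrm{GF}$ without free variables. The length $|\varphi|$ is the number of symbols of $\varphi$, where each occurrence of a parenthesis, connective, equality sign, quantifier, variable, relation symbol or constant symbol contributes $1$. The size of a structure is the cardinality of its domain, and $\log$ is the binary logarithm. There exist universal constants $0 < C_{\mathrm{lb}} < C_{\mathrm{ub}}$ such that the following holds. 1. Every satisfiable $\mathrm{GF}$-sentence $\varphi$ has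 a finite model whose size is at most $$2^{2^{\,C_{\mathrm{ub}}\cdot|\varphi|\cdot\log|\varphi|}}.$$ 2. For every $n\in\mathbb{N}$ there exists a satisfiable $\mathrm{GF}$-sentence $\varphi_n$ with $|\varphi_n|\ge n$ such that every model of $\varphi_n$ (finite or infinite) has size at least $$2^{2^{\,C_{\mathrm{lb}}\cdot|\varphi_n|\cdot\log|\varphi_n|}}.$$ -/

import Mathlib

open FirstOrder

universe u

namespace GuardedFragment

/-- The vocabulary of first-order logic without function symbols of positive arity: countably many
constant symbols (the functions of arity `0`) and, for every arity `k ≥ 1`, countably many relation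
symbols of arity `k`. -/
def vocab : Language where
  Functions k := {_i : ℕ // k = 0}
  Relations k := {_i : ℕ // 0 < k}

/-- First-order formulas over `vocab`, with variables named by natural numbers. All the usual
connectives and both quantifiers are primitive, because the length of a formula matters. A term in
`vocab.Term ℕ` is either a variable or a constant symbol. -/
inductive Formula : Type
  | top : Formula
  | bot : Formula
  | eq (s t : vocab.Term ℕ) : Formula
  | rel {k : ℕ} (R : vocab.Relations k) (ts : Fin k → vocab.Term ℕ) : Formula
  | not (φ : Formula) : Formula
  | and (φ ψ : Formula) : Formula
  | or (φ ψ : Formula) : Formula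
  | imp (φ ψ : Formula) : Formula
  | iff (φ ψ : Formula) : Formula
  | all (x : ℕ) (φ : Formula) : Formula
  | ex (x : ℕ) (φ : Formula) : Formula

namespace Formula

/-- The uniform length: the number of occurrences of symbols (parentheses, connectives, equality,
quantifiers, variables, relation symbols, constants) in the formula written as a word, where atoms
are written `s = t` and `R(t₁ … tₖ)`, binary connectives `(φ ∘ ψ)`, negations `¬φ`, and
quantifications `∀xφ`, `∃xφ`. Every term is a single symbol. -/
def length : Formula → ℕ
  | top => 1
  | bot => 1
  | eq _ _ => 3
  | rel (k := k) _ _ => k + 3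
  | not φ => φ.length + 1
  | and φ ψ => φ.length + ψ.length + 3
  | or φ ψ => φ.length + ψ.length + 3
  | imp φ ψ => φ.length + ψ.length + 3
  | iff φ ψ => φ.length + ψ.length + 3
  | all _ φ => φ.length + 2
  | ex _ φ => φ.length + 2

/-- The free variables of a formula. -/
def fv : Formula → Finset ℕ
  | top => ∅
  | bot => ∅
  | eq s t => s.varFinset ∪ t.varFinset
  | rel _ ts => Finset.univ.biUnion fun i => (ts i).varFinset
  | not φ => φ.fv
  | and φ ψ => φ.fv ∪ ψ.fv
  | or φ ψ => φ.fv ∪ ψ.fv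
  | imp φ ψ => φ.fv ∪ ψ.fv
  | iff φ ψ => φ.fv ∪ ψ.fv
  | all x φ => φ.fv.erase x
  | ex x φ => φ.fv.erase x

/-- `∀ x₁ … ∀ xₘ φ`. -/
def alls (xs : List ℕ) (φ : Formula) : Formula := xs.foldr all φ

/-- `∃ x₁ … ∃ xₘ φ`. -/
def exs (xs : List ℕ) (φ : Formula) : Formula := xs.foldr ex φ

/-- Atomic formulas: equalities and relational atoms. -/
inductive IsAtomic : Formula → Prop
  | eq (s t : vocab.Term ℕ) : IsAtomic (eq s t)
  | rel {k : ℕ} (R : vocab.Relations k) (ts : Fin k → vocab.Term ℕ) : IsAtomic (rel R ts)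

/-- The Guarded Fragment. -/
inductive IsGuarded : Formula → Prop
  | atomic {γ : Formula} : γ.IsAtomic → IsGuarded γ
  | top : IsGuarded top
  | bot : IsGuarded bot
  | not {φ : Formula} : IsGuarded φ → IsGuarded (not φ)
  | and {φ ψ : Formula} : IsGuarded φ → IsGuarded ψ → IsGuarded (and φ ψ)
  | or {φ ψ : Formula} : IsGuarded φ → IsGuarded ψ → IsGuarded (or φ ψ)
  | imp {φ ψ : Formula} : IsGuarded φ → IsGuarded ψ → IsGuarded (imp φ ψ)
  | iff {φ ψ : Formula} : IsGuarded φ → IsGuarded ψ → IsGuarded (iff φ ψ)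
  | all {γ ψ : Formula} (xs : List ℕ) : γ.IsAtomic → IsGuarded ψ → ψ.fv ⊆ γ.fv →
      (∀ x ∈ xs, x ∈ γ.fv) → IsGuarded (alls xs (imp γ ψ))
  | ex {γ ψ : Formula} (xs : List ℕ) : γ.IsAtomic → IsGuarded ψ → ψ.fv ⊆ γ.fv →
      (∀ x ∈ xs, x ∈ γ.fv) → IsGuarded (exs xs (and γ ψ))

/-- A sentence of the Guarded Fragment. -/
def IsGFSentence (φ : Formula) : Prop := φ.IsGuarded ∧ φ.fv = ∅

/-- Tarskian truth of a formula in the structure `A` under an assignment. -/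
def Holds {A : Type u} [vocab.Structure A] : Formula → (ℕ → A) → Prop
  | top, _ => True
  | bot, _ => False
  | eq s t, v => s.realize v = t.realize v
  | rel R ts, v => Language.Structure.RelMap R fun i => (ts i).realize v
  | not φ, v => ¬ φ.Holds v
  | and φ ψ, v => φ.Holds v ∧ ψ.Holds v
  | or φ ψ, v => φ.Holds v ∨ ψ.Holds v
  | imp φ ψ, v => φ.Holds v → ψ.Holds v
  | iff φ ψ, v => φ.Holds v ↔ ψ.Holds v
  | all x φ, v => ∀ a : A, φ.Holds (Function.update v x a)
  | ex x φ, v => ∃ a : A, φ.Holds (Function.update v x a)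

/-- `A` is a model of `φ`. A structure interprets the whole vocabulary; the interpretation of the
symbols that do not occur in `φ` is irrelevant. For a sentence, truth does not depend on the
assignment. -/
def Models (A : Type u) [vocab.Structure A] (φ : Formula) : Prop := ∀ v : ℕ → A, φ.Holds v

/-- `φ` has a model (finite or infinite, with non-empty domain). -/
def Satisfiable (φ : Formula) : Prop :=
  ∃ (A : Type u) (_ : Nonempty A) (_ : vocab.Structure A), Models A φ

end Formula

end GuardedFragment

/-! ### Terms, symbols and subformulas -/

namespace GuardedFragment

/-! Upper bound. A finite structure is glued from local pieces of a model `A`. A chart sends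
finitely many labelled points injectively to unnamed elements of `A`, and a relation holds of a
tuple when some chart through the tuple makes it true in `A`. Two demands compete: the type of a set
of points must depend on the points and not on the chart, yet every extension found in `A` must be
matched by adding points. Sums in `ZMod 2` meet both. An index stores one table for each set of
labels, and the type of a set of points with label set `M` is the sum of their entries at `M`. A
point with a fresh label chooses its summands last, so it can correct all the sums
(`Chart.exists_insert`); the sums mention only the points, so two charts agree wherever they overlap
(`Chart.holds_iff`). The tuples selected by a guard lie in a single chart, hence charts preserve
guarded formulas (`preserved_of_isGuarded`). As many labels as variables suffice. For length `n`
there are at most `2 ^ (n * (2n+1)^n * 2^n)` indices, which is doubly exponential in `O(n log n)`.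

Lower bound. A tuple of `k` distinct elements has `k!` rearrangements, and two permutations generate
them all, so a sentence of length linear in `k` can speak about all of them. It demands elements
that carry one bit per rearrangement, with each bit separately flippable. This forces `2 ^ k!`
elements (`FlipSystem.two_pow_factorial_le`), and `log k!` is of order `k log k`. -/

/-- The constant symbols occurring in a term. -/
def termConsts : vocab.Term ℕ → Finset ℕ
  | .var _ => ∅
  | .func f _ => {f.1}

theorem term_cases (t : vocab.Term ℕ) :
    (∃ x, t = .var x) ∨ ∃ c : ℕ, t = .func (l := 0) (⟨c, rfl⟩ : vocab.Functions 0) Fin.elim0 := by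
  cases t with
  | var x => exact .inl ⟨x, rfl⟩
  | func f ts =>
    rename_i l
    obtain ⟨c, hc⟩ := f
    subst hc
    exact .inr ⟨c, by congr; exact Subsingleton.elim _ _⟩

theorem varFinset_card_le (t : vocab.Term ℕ) : t.varFinset.card ≤ 1 := by
  rcases term_cases t with ⟨x, rfl⟩ | ⟨c, rfl⟩ <;> simp [Language.Term.varFinset]

theorem termConsts_card_le (t : vocab.Term ℕ) : (termConsts t).card ≤ 1 := by
  cases t <;> simp [termConsts]

theorem realize_congr {A : Type u} [vocab.Structure A] (t : vocab.Term ℕ) {v w : ℕ → A}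
    (h : ∀ x ∈ t.varFinset, v x = w x) : t.realize v = t.realize w := by
  rcases term_cases t with ⟨x, rfl⟩ | ⟨c, rfl⟩
  · simpa [Language.Term.varFinset] using h
  · simp only [Language.Term.realize]
    congr 1
    exact Subsingleton.elim _ _

namespace Formula

/-- All variables occurring in an atom of the formula, free or bound. -/
def vars : Formula → Finset ℕ
  | top => ∅
  | bot => ∅
  | eq s t => s.varFinset ∪ t.varFinset
  | rel _ ts => Finset.univ.biUnion fun i => (ts i).varFinset
  | not φ => φ.vars
  | and φ ψ => φ.vars ∪ ψ.vars
  | or φ ψ => φ.vars ∪ ψ.vars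
  | imp φ ψ => φ.vars ∪ ψ.vars
  | iff φ ψ => φ.vars ∪ ψ.vars
  | all _ φ => φ.vars
  | ex _ φ => φ.vars

/-- The constant symbols occurring in a formula. -/
def consts : Formula → Finset ℕ
  | top => ∅
  | bot => ∅
  | eq s t => termConsts s ∪ termConsts t
  | rel _ ts => Finset.univ.biUnion fun i => termConsts (ts i)
  | not φ => φ.consts
  | and φ ψ => φ.consts ∪ ψ.consts
  | or φ ψ => φ.consts ∪ ψ.consts
  | imp φ ψ => φ.consts ∪ ψ.consts
  | iff φ ψ => φ.consts ∪ ψ.consts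
  | all _ φ => φ.consts
  | ex _ φ => φ.consts

open Classical in
/-- The subformulas of a formula. -/
noncomputable def subs : Formula → Finset Formula
  | top => {top}
  | bot => {bot}
  | eq s t => {eq s t}
  | rel R ts => {rel R ts}
  | not φ => insert (not φ) φ.subs
  | and φ ψ => insert (and φ ψ) (φ.subs ∪ ψ.subs)
  | or φ ψ => insert (or φ ψ) (φ.subs ∪ ψ.subs)
  | imp φ ψ => insert (imp φ ψ) (φ.subs ∪ ψ.subs)
  | iff φ ψ => insert (iff φ ψ) (φ.subs ∪ ψ.subs)
  | all x φ => insert (all x φ) φ.subs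
  | ex x φ => insert (ex x φ) φ.subs

theorem self_mem_subs (φ : Formula) : φ ∈ φ.subs := by
  cases φ <;> simp [subs]

theorem fv_subset_vars (φ : Formula) : φ.fv ⊆ φ.vars := by
  induction φ with
  | top | bot | eq | rel => exact subset_rfl
  | not φ ih => exact ih
  | and φ ψ h₁ h₂ | or φ ψ h₁ h₂ | imp φ ψ h₁ h₂ | iff φ ψ h₁ h₂ =>
    exact Finset.union_subset_union h₁ h₂
  | all x φ ih | ex x φ ih => exact (Finset.erase_subset _ _).trans ih

theorem card_biUnion_fin_le {k : ℕ} (f : Fin k → Finset ℕ) (h : ∀ i, (f i).card ≤ 1) :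
    (Finset.univ.biUnion f).card ≤ k := by
  simpa using Finset.card_biUnion_le_card_mul Finset.univ f 1 fun i _ => h i

theorem vars_card_le (φ : Formula) : φ.vars.card ≤ φ.length := by
  induction φ with
  | top | bot => simp [vars]
  | eq s t =>
    have := Finset.card_union_le s.varFinset t.varFinset
    have := varFinset_card_le s
    have := varFinset_card_le t
    simp only [vars, length]; omega
  | rel R ts =>
    have := card_biUnion_fin_le (fun i => (ts i).varFinset) fun i => varFinset_card_le _
    simp only [vars, length]; omega
  | and φ ψ h₁ h₂ | or φ ψ h₁ h₂ | imp φ ψ h₁ h₂ | iff φ ψ h₁ h₂ =>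
    have := Finset.card_union_le φ.vars ψ.vars
    simp only [vars, length]; omega
  | not φ ih | all x φ ih | ex x φ ih => simp only [vars, length]; omega

theorem consts_card_le (φ : Formula) : φ.consts.card ≤ φ.length := by
  induction φ with
  | top | bot => simp [consts]
  | eq s t =>
    have := Finset.card_union_le (termConsts s) (termConsts t)
    have := termConsts_card_le s
    have := termConsts_card_le t
    simp only [consts, length]; omega
  | rel R ts =>
    have := card_biUnion_fin_le (fun i => termConsts (ts i)) fun i => termConsts_card_le _
    simp only [consts, length]; omega
  | and φ ψ h₁ h₂ | or φ ψ h₁ h₂ | imp φ ψ h₁ h₂ | iff φ ψ h₁ h₂ =>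
    have := Finset.card_union_le φ.consts ψ.consts
    simp only [consts, length]; omega
  | not φ ih | all x φ ih | ex x φ ih => simp only [consts, length]; omega

open Classical in
theorem subs_card_le (φ : Formula) : φ.subs.card ≤ φ.length := by
  induction φ with
  | top | bot => simp [subs, length]
  | eq s t => simp [subs, length]
  | rel R ts => simp [subs, length]
  | not φ ih =>
    have := Finset.card_insert_le (not φ) φ.subs
    simp only [subs, length]; omega
  | all x φ ih =>
    have := Finset.card_insert_le (all x φ) φ.subs
    simp only [subs, length]; omega
  | ex x φ ih =>
    have := Finset.card_insert_le (ex x φ) φ.subs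
    simp only [subs, length]; omega
  | and φ ψ h₁ h₂ =>
    have := Finset.card_insert_le (and φ ψ) (φ.subs ∪ ψ.subs)
    have := Finset.card_union_le φ.subs ψ.subs
    simp only [subs, length]; omega
  | or φ ψ h₁ h₂ =>
    have := Finset.card_insert_le (or φ ψ) (φ.subs ∪ ψ.subs)
    have := Finset.card_union_le φ.subs ψ.subs
    simp only [subs, length]; omega
  | imp φ ψ h₁ h₂ =>
    have := Finset.card_insert_le (imp φ ψ) (φ.subs ∪ ψ.subs)
    have := Finset.card_union_le φ.subs ψ.subs
    simp only [subs, length]; omega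
  | iff φ ψ h₁ h₂ =>
    have := Finset.card_insert_le (iff φ ψ) (φ.subs ∪ ψ.subs)
    have := Finset.card_union_le φ.subs ψ.subs
    simp only [subs, length]; omega

/-- The symbols and subformulas of `φ` are among the given ones. -/
structure Within (S : Finset Formula) (V C : Finset ℕ) (φ : Formula) : Prop where
  subs_subset : φ.subs ⊆ S
  vars_subset : φ.vars ⊆ V
  consts_subset : φ.consts ⊆ C

theorem Within.self (φ : Formula) : Within φ.subs φ.vars φ.consts φ :=
  ⟨subset_rfl, subset_rfl, subset_rfl⟩

section Within

variable {S : Finset Formula} {V C : Finset ℕ} {φ ψ : Formula} {x : ℕ}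

theorem Within.mem (h : Within S V C φ) : φ ∈ S := h.1 φ.self_mem_subs

theorem Within.fv_subset (h : Within S V C φ) : φ.fv ⊆ V := φ.fv_subset_vars.trans h.2

open Classical in
theorem Within.of_not (h : Within S V C (not φ)) : Within S V C φ :=
  ⟨(Finset.subset_insert _ _).trans h.1, h.2, h.3⟩

open Classical in
theorem Within.of_all (h : Within S V C (all x φ)) : Within S V C φ :=
  ⟨(Finset.subset_insert _ _).trans h.1, h.2, h.3⟩

open Classical in
theorem Within.of_ex (h : Within S V C (ex x φ)) : Within S V C φ :=
  ⟨(Finset.subset_insert _ _).trans h.1, h.2, h.3⟩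

open Classical in
theorem Within.of_and (h : Within S V C (and φ ψ)) : Within S V C φ ∧ Within S V C ψ :=
  have h₁ := Finset.union_subset_iff.1 ((Finset.subset_insert _ _).trans h.1)
  have h₂ := Finset.union_subset_iff.1 h.2
  have h₃ := Finset.union_subset_iff.1 h.3
  ⟨⟨h₁.1, h₂.1, h₃.1⟩, ⟨h₁.2, h₂.2, h₃.2⟩⟩

open Classical in
theorem Within.of_or (h : Within S V C (or φ ψ)) : Within S V C φ ∧ Within S V C ψ :=
  have h₁ := Finset.union_subset_iff.1 ((Finset.subset_insert _ _).trans h.1)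
  have h₂ := Finset.union_subset_iff.1 h.2
  have h₃ := Finset.union_subset_iff.1 h.3
  ⟨⟨h₁.1, h₂.1, h₃.1⟩, ⟨h₁.2, h₂.2, h₃.2⟩⟩

open Classical in
theorem Within.of_imp (h : Within S V C (imp φ ψ)) : Within S V C φ ∧ Within S V C ψ :=
  have h₁ := Finset.union_subset_iff.1 ((Finset.subset_insert _ _).trans h.1)
  have h₂ := Finset.union_subset_iff.1 h.2
  have h₃ := Finset.union_subset_iff.1 h.3
  ⟨⟨h₁.1, h₂.1, h₃.1⟩, ⟨h₁.2, h₂.2, h₃.2⟩⟩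

open Classical in
theorem Within.of_iff (h : Within S V C (iff φ ψ)) : Within S V C φ ∧ Within S V C ψ :=
  have h₁ := Finset.union_subset_iff.1 ((Finset.subset_insert _ _).trans h.1)
  have h₂ := Finset.union_subset_iff.1 h.2
  have h₃ := Finset.union_subset_iff.1 h.3
  ⟨⟨h₁.1, h₂.1, h₃.1⟩, ⟨h₁.2, h₂.2, h₃.2⟩⟩

theorem Within.of_alls {xs : List ℕ} (h : Within S V C (alls xs φ)) : Within S V C φ := by
  induction xs with
  | nil => exact h
  | cons x xs ih => exact ih h.of_all

theorem Within.of_exs {xs : List ℕ} (h : Within S V C (exs xs φ)) : Within S V C φ := by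
  induction xs with
  | nil => exact h
  | cons x xs ih => exact ih h.of_ex

end Within

theorem mem_fv_alls {xs : List ℕ} {φ : Formula} {x : ℕ} :
    x ∈ (alls xs φ).fv ↔ x ∈ φ.fv ∧ x ∉ xs := by
  induction xs with
  | nil => simp [alls]
  | cons y xs ih =>
    have : x ∈ (alls (y :: xs) φ).fv ↔ x ∈ (alls xs φ).fv.erase y := Iff.rfl
    rw [this, Finset.mem_erase, ih, List.mem_cons]
    tauto

theorem mem_fv_exs {xs : List ℕ} {φ : Formula} {x : ℕ} :
    x ∈ (exs xs φ).fv ↔ x ∈ φ.fv ∧ x ∉ xs := by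
  induction xs with
  | nil => simp [exs]
  | cons y xs ih =>
    have : x ∈ (exs (y :: xs) φ).fv ↔ x ∈ (exs xs φ).fv.erase y := Iff.rfl
    rw [this, Finset.mem_erase, ih, List.mem_cons]
    tauto

theorem length_alls (xs : List ℕ) (φ : Formula) :
    (alls xs φ).length = φ.length + 2 * xs.length := by
  induction xs with
  | nil => rfl
  | cons y xs ih =>
    have : (alls (y :: xs) φ).length = (alls xs φ).length + 2 := rfl
    rw [this, ih, List.length_cons]
    ring

theorem length_exs (xs : List ℕ) (φ : Formula) :
    (exs xs φ).length = φ.length + 2 * xs.length := by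
  induction xs with
  | nil => rfl
  | cons y xs ih =>
    have : (exs (y :: xs) φ).length = (exs xs φ).length + 2 := rfl
    rw [this, ih, List.length_cons]
    ring

/-! ### Semantics of quantifier blocks -/

section Semantics

variable {A : Type u} [vocab.Structure A]

theorem holds_exs {xs : List ℕ} {φ : Formula} {v : ℕ → A} :
    (exs xs φ).Holds v ↔ ∃ w : ℕ → A, (∀ x, x ∉ xs → w x = v x) ∧ φ.Holds w := by
  induction xs generalizing v with
  | nil =>
    refine ⟨fun h => ⟨v, fun _ _ => rfl, h⟩, ?_⟩
    rintro ⟨w, hw, h⟩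
    obtain rfl : w = v := funext fun x => hw x (by simp)
    exact h
  | cons y xs ih =>
    have : (exs (y :: xs) φ).Holds v ↔ ∃ a, (exs xs φ).Holds (Function.update v y a) := Iff.rfl
    rw [this]
    constructor
    · rintro ⟨a, ha⟩
      obtain ⟨w, hw, h⟩ := ih.1 ha
      refine ⟨w, fun x hx => ?_, h⟩
      rw [List.mem_cons, not_or] at hx
      rw [hw x hx.2, Function.update_of_ne hx.1]
    · rintro ⟨w, hw, h⟩
      refine ⟨w y, ih.2 ⟨w, fun x hx => ?_, h⟩⟩
      by_cases hxy : x = y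
      · subst hxy; simp
      · rw [Function.update_of_ne hxy]
        exact hw x (by simp [hx, hxy])

theorem holds_alls {xs : List ℕ} {φ : Formula} {v : ℕ → A} :
    (alls xs φ).Holds v ↔ ∀ w : ℕ → A, (∀ x, x ∉ xs → w x = v x) → φ.Holds w := by
  induction xs generalizing v with
  | nil =>
    refine ⟨fun h w hw => ?_, fun h => h v fun _ _ => rfl⟩
    obtain rfl : w = v := funext fun x => hw x (by simp)
    exact h
  | cons y xs ih =>
    have : (alls (y :: xs) φ).Holds v ↔ ∀ a, (alls xs φ).Holds (Function.update v y a) := Iff.rfl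
    rw [this]
    constructor
    · intro h w hw
      refine ih.1 (h (w y)) w fun x hx => ?_
      by_cases hxy : x = y
      · subst hxy; simp
      · rw [Function.update_of_ne hxy]
        exact hw x (by simp [hx, hxy])
    · intro h a
      refine ih.2 fun w hw => h w fun x hx => ?_
      rw [List.mem_cons, not_or] at hx
      rw [hw x hx.2, Function.update_of_ne hx.1]

/-- Reduces guarded universal quantification to the existential case. -/
theorem holds_alls_imp_iff_not_exs {xs : List ℕ} {γ ψ : Formula} {v : ℕ → A} :
    (alls xs (imp γ ψ)).Holds v ↔ ¬ (exs xs (and γ (not ψ))).Holds v := by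
  rw [holds_alls, holds_exs]
  simp [Holds]

theorem holds_congr (φ : Formula) {v w : ℕ → A} (h : ∀ x ∈ φ.fv, v x = w x) :
    φ.Holds v ↔ φ.Holds w := by
  induction φ generalizing v w with
  | top | bot => exact Iff.rfl
  | eq s t =>
    simp only [fv, Finset.mem_union] at h
    simp only [Holds]
    rw [realize_congr s fun x hx => h x (.inl hx), realize_congr t fun x hx => h x (.inr hx)]
  | rel R ts =>
    simp only [fv, Finset.mem_biUnion, Finset.mem_univ, true_and] at h
    simp only [Holds]
    rw [funext fun i => realize_congr (ts i) fun x hx => h x ⟨i, hx⟩]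
  | not φ ih => exact not_congr (ih h)
  | and φ ψ h₁ h₂ =>
    simp only [fv, Finset.mem_union] at h
    exact and_congr (h₁ fun x hx => h x (.inl hx)) (h₂ fun x hx => h x (.inr hx))
  | or φ ψ h₁ h₂ =>
    simp only [fv, Finset.mem_union] at h
    exact or_congr (h₁ fun x hx => h x (.inl hx)) (h₂ fun x hx => h x (.inr hx))
  | imp φ ψ h₁ h₂ =>
    simp only [fv, Finset.mem_union] at h
    exact imp_congr (h₁ fun x hx => h x (.inl hx)) (h₂ fun x hx => h x (.inr hx))
  | iff φ ψ h₁ h₂ =>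
    simp only [fv, Finset.mem_union] at h
    exact iff_congr (h₁ fun x hx => h x (.inl hx)) (h₂ fun x hx => h x (.inr hx))
  | all x φ ih =>
    refine forall_congr' fun a => ih fun y hy => ?_
    by_cases hyx : y = x
    · subst hyx; simp
    · rw [Function.update_of_ne hyx, Function.update_of_ne hyx]
      exact h y (Finset.mem_erase.2 ⟨hyx, hy⟩)
  | ex x φ ih =>
    refine exists_congr fun a => ih fun y hy => ?_
    by_cases hyx : y = x
    · subst hyx; simp
    · rw [Function.update_of_ne hyx, Function.update_of_ne hyx]
      exact h y (Finset.mem_erase.2 ⟨hyx, hy⟩)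

end Semantics

end Formula

end GuardedFragment

namespace GuardedFragment

/-! ### A finite model from charts

Given a structure `A`, finite sets `S` of formulas, `V` of variables and `C` of constant symbols,
we build a finite structure whose elements are the named elements of `A` together with pairs of a
label and an index. The indices are chosen so that any prescription of types for the sets
`L' ∪ {l}`, `L' ⊆ L`, can be met by some index at a new label `l`. -/

section Construction

variable {A : Type u} [vocab.Structure A] (a₀ : A) (S : Finset Formula) (V C : Finset ℕ)

/-- The interpretation of a constant symbol. -/
def constVal (A : Type u) [vocab.Structure A] (c : ℕ) : A :=
  Language.Structure.funMap (L := vocab) (n := 0) (⟨c, rfl⟩ : vocab.Functions 0) Fin.elim0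

open Classical in
/-- The interpretations of the constant symbols in `C`, together with the default element `a₀`. -/
noncomputable def named : Finset A := insert a₀ (C.image (constVal A))

/-- Formulas in `S` paired with assignments of named elements or labels to the variables. -/
abbrev Datum : Type u := {ψ // ψ ∈ S} × ({x // x ∈ V} → {a // a ∈ named a₀ C} ⊕ {x // x ∈ V})

/-- A truth table for data. -/
abbrev Table : Type u := Datum a₀ S V C → ZMod 2

/-- An index prescribes a summand for the table at each set of labels. -/
abbrev Index : Type u := Finset {x // x ∈ V} → Table a₀ S V C

variable {S V C a₀}

/-- The table attached to the points `(l, σ l)`, `l ∈ L`. -/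
def color (L : Finset {x // x ∈ V}) (σ : {x // x ∈ V} → Index a₀ S V C) : Table a₀ S V C :=
  ∑ l ∈ L, σ l L

/-- The assignment in `A` given by an assignment of named elements and labels. -/
noncomputable def assign (h : {x // x ∈ V} → A)
    (f : {x // x ∈ V} → {a // a ∈ named a₀ C} ⊕ {x // x ∈ V}) (n : ℕ) : A :=
  if hn : n ∈ V then Sum.elim Subtype.val h (f ⟨n, hn⟩) else a₀

open Classical in
/-- The table of the data over the labels in `L` that hold in `A` under the labelling `h`. -/
noncomputable def table (h : {x // x ∈ V} → A) (L : Finset {x // x ∈ V}) : Table a₀ S V C :=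
  fun d => if (∀ x : {x // x ∈ V}, x.1 ∈ d.1.1.fv → ∀ l, d.2 x = .inr l → l ∈ L) ∧
    d.1.1.Holds (assign h d.2) then 1 else 0

/-- The test in `table` rejects every datum whose free variables use a label outside `L`, so values
of the labelling elsewhere are never consulted. -/
theorem table_congr {h h' : {x // x ∈ V} → A} {L : Finset {x // x ∈ V}}
    (hh : ∀ l ∈ L, h l = h' l) : (table h L : Table a₀ S V C) = table h' L := by
  funext d
  unfold table
  congr 1
  refine propext (and_congr_right fun hd => Formula.holds_congr _ fun n hn => ?_)
  unfold assign
  split_ifs with hV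
  · cases hx : d.2 ⟨n, hV⟩ with
    | inl a => rfl
    | inr l => exact hh l (hd ⟨n, hV⟩ hn l hx)
  · rfl

theorem color_congr {L : Finset {x // x ∈ V}} {σ τ : {x // x ∈ V} → Index a₀ S V C}
    (h : ∀ l ∈ L, σ l = τ l) : color L σ = color L τ :=
  Finset.sum_congr rfl fun l hl => by rw [h l hl]

/-- `h` maps the points `(l, σ l)`, `l ∈ L`, to distinct unnamed elements of `A` whose types are
those prescribed by the indices. -/
structure Chart (L : Finset {x // x ∈ V}) (σ : {x // x ∈ V} → Index a₀ S V C)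
    (h : {x // x ∈ V} → A) : Prop where
  injOn : Set.InjOn h L
  notMem : ∀ l ∈ L, h l ∉ named a₀ C
  color_eq : ∀ M ⊆ L, M.Nonempty → color M σ = table h M

variable {L M : Finset {x // x ∈ V}} {σ τ : {x // x ∈ V} → Index a₀ S V C} {h g : {x // x ∈ V} → A}

theorem Chart.empty : Chart ∅ σ h :=
  ⟨by simp, by simp, fun M hM hne => absurd (Finset.subset_empty.1 hM) hne.ne_empty⟩

theorem Chart.mono (H : Chart L σ h) (hM : M ⊆ L) : Chart M σ h :=
  ⟨H.injOn.mono (by exact_mod_cast hM), fun l hl => H.notMem l (hM hl),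
    fun N hN => H.color_eq N (hN.trans hM)⟩

theorem Chart.congr (H : Chart L σ h) (hστ : ∀ l ∈ L, σ l = τ l) : Chart L τ h :=
  ⟨H.injOn, H.notMem, fun M hM hne => by
    rw [← H.color_eq M hM hne, color_congr fun l hl => hστ l (hM hl)]⟩

open Classical in
-- The new index takes, at each `M` containing `l`, the wanted table minus the summands of the other
-- members. These equations are independent because each `M` has its own entry. Sets without `l` do
-- not read the new index.
theorem Chart.exists_insert (H : Chart L σ h) {l : {x // x ∈ V}} (hl : l ∉ L) {a : A}
    (ha : a ∉ named a₀ C) (haL : a ∉ L.image h) :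
    ∃ i, Chart (insert l L) (Function.update σ l i) (Function.update h l a) := by
  have hne : ∀ {k}, k ∈ L → k ≠ l := fun hk => by rintro rfl; exact hl hk
  refine ⟨fun M => table (Function.update h l a) M - ∑ k ∈ M.erase l, σ k M, ?_, ?_, ?_⟩
  · rw [Finset.coe_insert, Set.injOn_insert (by simpa using hl)]
    constructor
    · intro x hx y hy hxy
      rw [Function.update_of_ne (hne hx), Function.update_of_ne (hne hy)] at hxy
      exact H.injOn hx hy hxy
    · rintro ⟨x, hx, hxy⟩
      rw [Function.update_of_ne (hne hx), Function.update_self] at hxy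
      exact haL (Finset.mem_image.2 ⟨x, hx, hxy⟩)
  · intro k hk
    rcases Finset.mem_insert.1 hk with rfl | hk
    · simpa using ha
    · rw [Function.update_of_ne (hne hk)]
      exact H.notMem k hk
  · intro M hM hMne
    by_cases hlM : l ∈ M
    · rw [color, ← Finset.add_sum_erase M _ hlM, Function.update_self]
      have : ∑ k ∈ M.erase l, Function.update σ l (fun M => table (Function.update h l a) M -
          ∑ k ∈ M.erase l, σ k M) k M = ∑ k ∈ M.erase l, σ k M :=
        Finset.sum_congr rfl fun k hk => by
          rw [Function.update_of_ne (Finset.ne_of_mem_erase hk)]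
      rw [this, sub_add_cancel]
    · have hML : M ⊆ L := fun k hk =>
        (Finset.mem_insert.1 (hM hk)).resolve_left fun h => hlM (h ▸ hk)
      rw [color_congr (τ := σ) fun k hk => Function.update_of_ne (hne (hML hk)) _ _,
        table_congr (h' := h) fun k hk => Function.update_of_ne (hne (hML hk)) _ _]
      exact H.color_eq M hML hMne

open Classical in
-- Elements of `W` are added one at a time. Injectivity makes the number of labels in use equal to
-- the number of elements covered, which stays below `V.card` until `W` is exhausted, so a fresh
-- label is always available.
theorem Chart.exists_extension (W : Finset A) (hW : ∀ a ∈ W, a ∉ named a₀ C)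
    (hcard : W.card ≤ V.card) (H : Chart L σ h) (hLW : L.image h ⊆ W) :
    ∃ (L' : Finset {x // x ∈ V}) (σ' : {x // x ∈ V} → Index a₀ S V C) (h' : {x // x ∈ V} → A),
      Chart L' σ' h' ∧ L ⊆ L' ∧ (∀ l ∈ L, σ' l = σ l ∧ h' l = h l) ∧ L'.image h' = W := by
  induction hn : (W \ L.image h).card generalizing L σ h with
  | zero =>
    refine ⟨L, σ, h, H, subset_rfl, fun _ _ => ⟨rfl, rfl⟩, hLW.antisymm ?_⟩
    exact Finset.sdiff_eq_empty_iff_subset.1 (Finset.card_eq_zero.1 hn)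
  | succ n ih =>
    obtain ⟨a, ha⟩ : (W \ L.image h).Nonempty := Finset.card_pos.1 (by omega)
    rw [Finset.mem_sdiff] at ha
    have hlt : L.card < (Finset.univ : Finset {x // x ∈ V}).card := by
      have h₁ : (L.image h).card = L.card := Finset.card_image_of_injOn H.injOn
      have h₂ : (L.image h).card < W.card :=
        Finset.card_lt_card ⟨hLW, fun h' => ha.2 (h' ha.1)⟩
      simp only [Finset.card_univ, Fintype.card_coe]
      omega
    obtain ⟨l, -, hl⟩ := Finset.exists_mem_notMem_of_card_lt_card hlt
    obtain ⟨i, Hi⟩ := H.exists_insert hl (hW a ha.1) ha.2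
    have hne : ∀ {k}, k ∈ L → k ≠ l := fun hk => by rintro rfl; exact hl hk
    have himg : (insert l L).image (Function.update h l a) = insert a (L.image h) := by
      rw [Finset.image_insert, Function.update_self]
      congr 1
      exact Finset.image_congr fun k hk => Function.update_of_ne (hne hk) _ _
    obtain ⟨L', σ', h', H', hL', hag, hWeq⟩ := ih Hi
      (by rw [himg]; exact Finset.insert_subset ha.1 hLW)
      (by
        rw [himg, Finset.sdiff_insert, Finset.card_erase_of_mem (Finset.mem_sdiff.2 ha), hn]
        rfl)
    refine ⟨L', σ', h', H', (Finset.subset_insert _ _).trans hL', fun k hk => ?_, hWeq⟩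
    have := hag k (Finset.mem_insert_of_mem hk)
    rwa [Function.update_of_ne (hne hk), Function.update_of_ne (hne hk)] at this

/-! ### The finite structure -/

variable (a₀ S V C) in
/-- The domain of the finite structure: named elements, and labelled indices that have a chart. -/
abbrev Point : Type u :=
  {a // a ∈ named a₀ C} ⊕
    {p : {x // x ∈ V} × Index a₀ S V C // ∃ h : {x // x ∈ V} → A, Chart {p.1} (fun _ => p.2) h}

/-- The element is named or of the form `(l, σ l)` with `l ∈ L`. -/
def Point.In (L : Finset {x // x ∈ V}) (σ : {x // x ∈ V} → Index a₀ S V C) :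
    Point a₀ S V C → Prop
  | .inl _ => True
  | .inr p => p.1.1 ∈ L ∧ σ p.1.1 = p.1.2

/-- The map to `A` induced by a labelling. -/
def Point.push (h : {x // x ∈ V} → A) : Point a₀ S V C → A
  | .inl a => a.1
  | .inr p => h p.1.1

/-- The named element or the label of a point. -/
def Point.label : Point a₀ S V C → {a // a ∈ named a₀ C} ⊕ {x // x ∈ V}
  | .inl a => .inl a
  | .inr p => .inr p.1.1

theorem Chart.push_injective (H : Chart L σ h) {b c : Point a₀ S V C} (hb : b.In L σ)
    (hc : c.In L σ) : b.push h = c.push h ↔ b = c := by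
  refine ⟨fun hbc => ?_, fun hbc => hbc ▸ rfl⟩
  rcases b with b | b <;> rcases c with c | c
  · exact congrArg _ (Subtype.ext hbc)
  · exact absurd b.2 (by rw [show b.1 = h c.1.1 from hbc]; exact H.notMem _ hc.1)
  · exact absurd c.2 (by rw [← show h b.1.1 = c.1 from hbc]; exact H.notMem _ hb.1)
  · have h₁ : b.1.1 = c.1.1 := H.injOn hb.1 hc.1 hbc
    have h₂ : b.1.2 = c.1.2 := by rw [← hb.2, ← hc.2, h₁]
    exact congrArg _ (Subtype.ext (Prod.ext h₁ h₂))

theorem Chart.exists_point (H : Chart L σ h) {a : A} (ha : a ∈ named a₀ C ∨ ∃ l ∈ L, h l = a) :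
    ∃ b : Point a₀ S V C, b.In L σ ∧ b.push h = a := by
  rcases ha with ha | ⟨l, hl, rfl⟩
  · exact ⟨.inl ⟨a, ha⟩, trivial, rfl⟩
  · refine ⟨.inr ⟨(l, σ l), h, ?_⟩, ⟨hl, rfl⟩, rfl⟩
    exact (H.mono (Finset.singleton_subset_iff.2 hl)).congr (by simp)

/-- The reason why unnamed points are required to have a singleton chart: an equality used as a
guard supplies no other chart. -/
theorem Point.exists_chart (b : Point a₀ S V C) :
    ∃ (L : Finset {x // x ∈ V}) (σ : {x // x ∈ V} → Index a₀ S V C) (h : {x // x ∈ V} → A),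
      Chart L σ h ∧ b.In L σ := by
  rcases b with b | ⟨p, h, hp⟩
  · exact ⟨∅, fun _ _ => 0, fun _ => a₀, .empty, trivial⟩
  · exact ⟨_, _, h, hp, Finset.mem_singleton_self _, rfl⟩

theorem assign_label {v : ℕ → Point a₀ S V C} {n : ℕ} (hn : n ∈ V) :
    assign h (fun x => (v x.1).label) n = (v n).push h := by
  rw [assign, dif_pos hn]
  rcases v n with a | p <;> rfl

open Classical in
/-- Two charts through the same points agree on the formulas of `S` at these points. -/
theorem Chart.holds_iff (H : Chart L σ h) (G : Chart M τ g) {ψ : Formula} (hS : ψ ∈ S)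
    (hV : ψ.fv ⊆ V) {v : ℕ → Point a₀ S V C} (h₁ : ∀ x ∈ ψ.fv, (v x).In L σ)
    (h₂ : ∀ x ∈ ψ.fv, (v x).In M τ) :
    ψ.Holds (fun x => (v x).push h) ↔ ψ.Holds (fun x => (v x).push g) := by
  let N : Finset {x // x ∈ V} := Finset.univ.filter fun l => ∃ x ∈ ψ.fv, (v x).label = .inr l
  have hN : ∀ l ∈ N, l ∈ L ∧ l ∈ M ∧ σ l = τ l := by
    intro l hl
    obtain ⟨x, hx, hxl⟩ := (Finset.mem_filter.1 hl).2
    have h₁ := h₁ x hx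
    have h₂ := h₂ x hx
    rcases hvx : v x with a | p <;> rw [hvx] at hxl h₁ h₂
    · cases hxl
    · cases hxl
      exact ⟨h₁.1, h₂.1, h₁.2.trans h₂.2.symm⟩
  -- An empty sum is zero and encodes no type, so charts say nothing at the empty set; in that case
  -- all values are named and no labelling matters.
  rcases N.eq_empty_or_nonempty with hemp | hne
  · refine Formula.holds_congr _ fun x hx => ?_
    rcases hvx : v x with a | p
    · rfl
    · have : p.1.1 ∈ N := Finset.mem_filter.2 ⟨Finset.mem_univ _, x, hx, by rw [hvx]; rfl⟩
      rw [hemp] at this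
      exact absurd this (Finset.notMem_empty _)
  · have key : (table h N : Table a₀ S V C) = table g N := by
      rw [← H.color_eq N (fun l hl => (hN l hl).1) hne,
        ← G.color_eq N (fun l hl => (hN l hl).2.1) hne, color_congr fun l hl => (hN l hl).2.2]
    have key := congrFun key (⟨ψ, hS⟩, fun x => (v x.1).label)
    have hc : ∀ x : {x // x ∈ V}, x.1 ∈ ψ.fv → ∀ l, (v x.1).label = .inr l → l ∈ N :=
      fun x hx l hl => Finset.mem_filter.2 ⟨Finset.mem_univ _, x.1, hx, hl⟩
    have hh : ∀ k : {x // x ∈ V} → A, ψ.Holds (fun x => (v x).push k) ↔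
        ψ.Holds (assign k fun x => (v x.1).label) := fun k =>
      Formula.holds_congr _ fun x hx => (assign_label (hV hx)).symm
    rw [hh, hh]
    by_cases p : ψ.Holds (assign h fun x => (v x.1).label) <;>
      by_cases q : ψ.Holds (assign g fun x => (v x.1).label) <;>
      simp only [table, p, q, and_true, and_false, if_pos hc, if_false, one_ne_zero,
        zero_ne_one] at key ⊢

open Classical in
-- Constants whose value is not named get the junk value `a₀`; those in `C` are never affected.
-- Requiring a chart for each related tuple is what lets guards deliver charts.
noncomputable instance : vocab.Structure (Point a₀ S V C) where
  funMap f _ := .inl (if hf : constVal A f.1 ∈ named a₀ C then ⟨_, hf⟩ else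
    ⟨a₀, Finset.mem_insert_self _ _⟩)
  RelMap R b := ∃ (L : Finset {x // x ∈ V}) (σ : {x // x ∈ V} → Index a₀ S V C)
    (h : {x // x ∈ V} → A), Chart L σ h ∧ (∀ i, (b i).In L σ) ∧
      Language.Structure.RelMap R fun i => (b i).push h

open Classical in
theorem push_realize {t : vocab.Term ℕ} (ht : termConsts t ⊆ C) (v : ℕ → Point a₀ S V C) :
    (t.realize v).push h = t.realize fun x => (v x).push h := by
  rcases term_cases t with ⟨x, rfl⟩ | ⟨c, rfl⟩
  · rfl
  · have hc : constVal A c ∈ named a₀ C := by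
      refine Finset.mem_insert_of_mem (Finset.mem_image_of_mem _ (ht ?_))
      simp [termConsts]
    simp only [Language.Term.realize, Language.Structure.funMap]
    rw [dif_pos hc]
    simp only [Point.push, constVal]
    congr 1
    exact Subsingleton.elim _ _

theorem realize_in {t : vocab.Term ℕ} {v : ℕ → Point a₀ S V C} :
    (t.realize v).In L σ ↔ ∀ x ∈ t.varFinset, (v x).In L σ := by
  rcases term_cases t with ⟨x, rfl⟩ | ⟨c, rfl⟩
  · simp [Language.Term.varFinset]
  · simp only [Language.Term.realize, Language.Structure.funMap, Language.Term.varFinset]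
    simp [Point.In]

/-! ### Preservation of guarded formulas -/

variable (a₀ S V C) in
/-- Charts preserve and reflect the truth of `ψ`. -/
def Preserved (ψ : Formula) : Prop :=
  ∀ (L : Finset {x // x ∈ V}) (σ : {x // x ∈ V} → Index a₀ S V C) (h : {x // x ∈ V} → A)
    (v : ℕ → Point a₀ S V C), Chart L σ h → (∀ x ∈ ψ.fv, (v x).In L σ) →
      (ψ.Holds v ↔ ψ.Holds fun x => (v x).push h)

theorem preserved_of_isAtomic {γ : Formula} (hγ : γ.IsAtomic) (hw : γ.Within S V C) :
    Preserved a₀ S V C γ := by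
  intro L σ h v H hv
  cases hγ with
  | eq s t =>
    simp only [Formula.fv, Finset.mem_union] at hv
    have hc := Finset.union_subset_iff.1 hw.consts_subset
    simp only [Formula.Holds]
    rw [← push_realize hc.1, ← push_realize hc.2, H.push_injective]
    · exact realize_in.2 fun x hx => hv x (.inl hx)
    · exact realize_in.2 fun x hx => hv x (.inr hx)
  | rel R ts =>
    have hcs : ∀ i, termConsts (ts i) ⊆ C := fun i =>
      (Finset.subset_biUnion_of_mem (fun i => termConsts (ts i)) (Finset.mem_univ i)).trans
        hw.consts_subset
    have hr : ∀ k : {x // x ∈ V} → A, (Formula.rel R ts).Holds (fun x => (v x).push k) ↔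
        Language.Structure.RelMap R fun i => ((ts i).realize v).push k := fun k => by
      simp only [Formula.Holds, push_realize (hcs _)]
    constructor
    · rintro ⟨M, τ, g, G, hb, hR⟩
      -- The chart witnessing the relation need not be the given one, so the atom is moved between
      -- the two.
      refine (G.holds_iff H hw.mem hw.fv_subset ?_ hv).1 ((hr g).2 hR)
      intro x hx
      obtain ⟨i, -, hi⟩ := Finset.mem_biUnion.1 hx
      exact realize_in.1 (hb i) x hi
    · intro hR
      refine ⟨L, σ, h, H, fun i => realize_in.2 fun x hx => hv x ?_, (hr h).1 hR⟩
      exact Finset.mem_biUnion.2 ⟨i, Finset.mem_univ _, hx⟩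

/-- The variables of a true atomic formula lie in a common chart. -/
theorem exists_chart_of_isAtomic {γ : Formula} (hγ : γ.IsAtomic) {v : ℕ → Point a₀ S V C}
    (hv : γ.Holds v) : ∃ (L : Finset {x // x ∈ V}) (σ : {x // x ∈ V} → Index a₀ S V C)
      (h : {x // x ∈ V} → A), Chart L σ h ∧ ∀ x ∈ γ.fv, (v x).In L σ := by
  cases hγ with
  | eq s t =>
    obtain ⟨L, σ, h, H, hb⟩ := (s.realize v).exists_chart
    refine ⟨L, σ, h, H, fun x hx => ?_⟩
    rcases Finset.mem_union.1 hx with hx | hx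
    · exact realize_in.1 hb x hx
    · exact realize_in.1 (show (t.realize v).In L σ from (show s.realize v = _ from hv) ▸ hb) x hx
  | rel R ts =>
    obtain ⟨L, σ, h, H, hb, -⟩ := hv
    refine ⟨L, σ, h, H, fun x hx => ?_⟩
    obtain ⟨i, -, hi⟩ := Finset.mem_biUnion.1 hx
    exact realize_in.1 (hb i) x hi

open Classical in
-- Agreement between charts is the hypothesis `hag` instead of membership in `S`, so that the lemma
-- also covers the dual of a universal formula, which need not be a subformula.
theorem preserved_exs {xs : List ℕ} {γ ψ : Formula} (hγ : γ.IsAtomic)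
    (hγp : Preserved a₀ S V C γ) (hψp : Preserved a₀ S V C ψ) (hfv : ψ.fv ⊆ γ.fv)
    (hxs : ∀ x ∈ xs, x ∈ γ.fv) (hV : γ.fv ⊆ V)
    (hag : ∀ (L M : Finset {x // x ∈ V}) (σ τ : {x // x ∈ V} → Index a₀ S V C)
      (h g : {x // x ∈ V} → A) (v : ℕ → Point a₀ S V C), Chart L σ h → Chart M τ g →
      (∀ x ∈ γ.fv, x ∉ xs → (v x).In L σ ∧ (v x).In M τ) →
      (Formula.exs xs (.and γ ψ)).Holds (fun x => (v x).push h) →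
      (Formula.exs xs (.and γ ψ)).Holds (fun x => (v x).push g)) :
    Preserved a₀ S V C (.exs xs (.and γ ψ)) := by
  intro L σ h v H hv
  have hv : ∀ x ∈ γ.fv, x ∉ xs → (v x).In L σ := fun x hx hxs =>
    hv x (Formula.mem_fv_exs.2 ⟨Finset.mem_union_left _ hx, hxs⟩)
  constructor
  · intro hB
    obtain ⟨w, hw, hγw, hψw⟩ := Formula.holds_exs.1 hB
    obtain ⟨M, τ, g, G, hin⟩ := exists_chart_of_isAtomic hγ hγw
    -- The guard's chart contains the witnesses but may differ from the given chart; both contain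
    -- the parameters.
    refine hag M L τ σ g h v G H (fun x hx hxs => ⟨hw x hxs ▸ hin x hx, hv x hx hxs⟩) ?_
    refine Formula.holds_exs.2 ⟨fun x => (w x).push g, fun x hx => congrArg _ (hw x hx), ?_, ?_⟩
    · exact (hγp M τ g w G hin).1 hγw
    · exact (hψp M τ g w G fun x hx => hin x (hfv hx)).1 hψw
  · intro hA
    obtain ⟨w, hw, hγw, hψw⟩ := Formula.holds_exs.1 hA
    -- Only the labels of parameters are kept, which frees the others for the witnesses. `W`
    -- collects all unnamed values to be covered.
    let L₀ := L.filter fun l => ∃ x ∈ γ.fv, x ∉ xs ∧ (v x).label = .inr l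
    let W := (γ.fv.image w).filter fun a => a ∉ named a₀ C
    have hL₀ : L₀.image h ⊆ W := by
      intro a ha
      obtain ⟨l, hl, rfl⟩ := Finset.mem_image.1 ha
      obtain ⟨hlL, x, hx, hxs, hxl⟩ := Finset.mem_filter.1 hl
      refine Finset.mem_filter.2 ⟨Finset.mem_image.2 ⟨x, hx, ?_⟩, H.notMem l hlL⟩
      rw [hw x hxs]
      rcases hvx : v x with a | p <;> rw [hvx] at hxl <;> cases hxl
      rfl
    have hWc : W.card ≤ V.card :=
      (Finset.card_filter_le _ _).trans (Finset.card_image_le.trans (Finset.card_le_card hV))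
    obtain ⟨M, τ, g, G, hL₀M, hagr, himg⟩ := (H.mono (Finset.filter_subset _ L)).exists_extension
      W (fun a ha => (Finset.mem_filter.1 ha).2) hWc hL₀
    have hpt : ∀ x ∈ γ.fv, ∃ b : Point a₀ S V C, b.In M τ ∧ b.push g = w x := by
      intro x hx
      refine G.exists_point ?_
      by_cases hK : w x ∈ named a₀ C
      · exact .inl hK
      · have : w x ∈ M.image g := by
          rw [himg]; exact Finset.mem_filter.2 ⟨Finset.mem_image_of_mem _ hx, hK⟩
        simpa using Or.inr (b := ∃ l ∈ M, g l = w x) (Finset.mem_image.1 this)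
    have hold : ∀ x ∈ γ.fv, x ∉ xs → (v x).In M τ ∧ (v x).push g = w x := by
      intro x hx hxs
      have h₁ := hv x hx hxs
      rw [hw x hxs]
      rcases hvx : v x with a | p
      · exact ⟨trivial, rfl⟩
      · rw [hvx] at h₁
        have hp : p.1.1 ∈ L₀ := Finset.mem_filter.2 ⟨h₁.1, x, hx, hxs, by rw [hvx]; rfl⟩
        exact ⟨⟨hL₀M hp, (hagr _ hp).1.trans h₁.2⟩, (hagr _ hp).2⟩
    choose b hb using hpt
    let v' : ℕ → Point a₀ S V C := fun x => if hx : x ∈ xs then b x (hxs x hx) else v x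
    have hv' : ∀ x ∈ γ.fv, (v' x).In M τ ∧ (v' x).push g = w x := by
      intro x hx
      by_cases hxs : x ∈ xs
      · simp only [v', dif_pos hxs]; exact hb x hx
      · simp only [v', dif_neg hxs]; exact hold x hx hxs
    refine Formula.holds_exs.2 ⟨v', fun x hx => dif_neg hx, ?_, ?_⟩
    · refine (hγp M τ g v' G fun x hx => (hv' x hx).1).2 ?_
      exact (Formula.holds_congr _ fun x hx => (hv' x hx).2).2 hγw
    · refine (hψp M τ g v' G fun x hx => (hv' x (hfv hx)).1).2 ?_
      exact (Formula.holds_congr _ fun x hx => (hv' x (hfv hx)).2).2 hψw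

theorem preserved_of_isGuarded {ψ : Formula} (hψ : ψ.IsGuarded) (hw : ψ.Within S V C) :
    Preserved a₀ S V C ψ := by
  induction hψ with
  | atomic hγ => exact preserved_of_isAtomic hγ hw
  | top | bot => exact fun _ _ _ _ _ _ => Iff.rfl
  | not _ ih => exact fun L σ h v H hv => not_congr (ih hw.of_not L σ h v H hv)
  | and _ _ h₁ h₂ =>
    exact fun L σ h v H hv => and_congr
      (h₁ hw.of_and.1 L σ h v H fun x hx => hv x (Finset.mem_union_left _ hx))
      (h₂ hw.of_and.2 L σ h v H fun x hx => hv x (Finset.mem_union_right _ hx))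
  | or _ _ h₁ h₂ =>
    exact fun L σ h v H hv => or_congr
      (h₁ hw.of_or.1 L σ h v H fun x hx => hv x (Finset.mem_union_left _ hx))
      (h₂ hw.of_or.2 L σ h v H fun x hx => hv x (Finset.mem_union_right _ hx))
  | imp _ _ h₁ h₂ =>
    exact fun L σ h v H hv => imp_congr
      (h₁ hw.of_imp.1 L σ h v H fun x hx => hv x (Finset.mem_union_left _ hx))
      (h₂ hw.of_imp.2 L σ h v H fun x hx => hv x (Finset.mem_union_right _ hx))
  | iff _ _ h₁ h₂ =>
    exact fun L σ h v H hv => iff_congr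
      (h₁ hw.of_iff.1 L σ h v H fun x hx => hv x (Finset.mem_union_left _ hx))
      (h₂ hw.of_iff.2 L σ h v H fun x hx => hv x (Finset.mem_union_right _ hx))
  | @ex γ ψ xs hγ _ hfv hxs ih =>
    have hw' := hw.of_exs.of_and
    refine preserved_exs hγ (preserved_of_isAtomic hγ hw'.1) (ih hw'.2) hfv hxs hw'.1.fv_subset ?_
    intro L M σ τ h g v H G hv
    have hx : ∀ x ∈ (Formula.exs xs (.and γ ψ)).fv, x ∈ γ.fv ∧ x ∉ xs := fun x hx =>
      ⟨(Finset.mem_union.1 (Formula.mem_fv_exs.1 hx).1).elim id (hfv ·),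
        (Formula.mem_fv_exs.1 hx).2⟩
    exact (H.holds_iff G hw.mem hw.fv_subset (fun x hx' => (hv x (hx x hx').1 (hx x hx').2).1)
      fun x hx' => (hv x (hx x hx').1 (hx x hx').2).2).1
  | @all γ ψ xs hγ _ hfv hxs ih =>
    have hw' := hw.of_alls.of_imp
    have hx : ∀ x ∈ (Formula.alls xs (.imp γ ψ)).fv, x ∈ γ.fv ∧ x ∉ xs := fun x hx =>
      ⟨(Finset.mem_union.1 (Formula.mem_fv_alls.1 hx).1).elim id (hfv ·),
        (Formula.mem_fv_alls.1 hx).2⟩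
    -- Agreement for this dual formula is read off from the universal formula itself, which does lie
    -- in `S`.
    have key : Preserved a₀ S V C (.exs xs (.and γ (.not ψ))) := by
      refine preserved_exs hγ (preserved_of_isAtomic hγ hw'.1)
        (fun L σ h v H hv => not_congr (ih hw'.2 L σ h v H hv)) hfv hxs hw'.1.fv_subset ?_
      intro L M σ τ h g v H G hv
      have := H.holds_iff G hw.mem hw.fv_subset
        (fun x hx' => (hv x (hx x hx').1 (hx x hx').2).1)
        fun x hx' => (hv x (hx x hx').1 (hx x hx').2).2
      rw [Formula.holds_alls_imp_iff_not_exs, Formula.holds_alls_imp_iff_not_exs,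
        not_iff_not] at this
      exact this.1
    intro L σ h v H hv
    rw [Formula.holds_alls_imp_iff_not_exs, Formula.holds_alls_imp_iff_not_exs]
    refine not_congr (key L σ h v H fun x hx => hv x ?_)
    rw [Formula.mem_fv_exs] at hx
    exact Formula.mem_fv_alls.2 hx

variable (a₀ S V C) in
open Classical in
theorem card_point_le : Nat.card (Point a₀ S V C) ≤
    (C.card + 1) + V.card * 2 ^ (S.card * (C.card + 1 + V.card) ^ V.card * 2 ^ V.card) := by
  have hK : Nat.card {a // a ∈ named a₀ C} ≤ C.card + 1 := by
    rw [Nat.card_eq_fintype_card, Fintype.card_coe]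
    exact (Finset.card_insert_le _ _).trans (Nat.add_le_add_right Finset.card_image_le 1)
  have hV : Nat.card {x // x ∈ V} = V.card := by simp
  have hS : Nat.card {ψ // ψ ∈ S} = S.card := by simp
  have hF : Nat.card (Finset {x // x ∈ V}) = 2 ^ V.card := by simp
  have hI : Nat.card (Index a₀ S V C) ≤
      2 ^ (S.card * (C.card + 1 + V.card) ^ V.card * 2 ^ V.card) := by
    rw [Nat.card_fun, Nat.card_fun, Nat.card_prod, Nat.card_fun, Nat.card_sum, Nat.card_zmod, hV,
      hS, hF, ← pow_mul]
    gcongr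
    norm_num
  rw [Nat.card_sum]
  refine add_le_add hK ((Finite.card_subtype_le _).trans ?_)
  rw [Nat.card_prod, hV]
  exact Nat.mul_le_mul_left _ hI

end Construction

/-! ### The doubly exponential upper bound -/

theorem numeric_bound {n : ℕ} (hn : 2 ≤ n) :
    (n + 1) + n * 2 ^ (n * (n + 1 + n) ^ n * 2 ^ n) ≤ 2 ^ n ^ (6 * n) := by
  have hnn : n ≤ n ^ n := Nat.le_self_pow (by omega) n
  have h₁ : n * (n + 1 + n) ^ n * 2 ^ n ≤ n ^ (5 * n) := by
    -- The three factors cost `n`, `3n` and `n` in the exponent of `n`; a further `n ^ n ≥ 4`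
    -- absorbs the lower-order terms, whence `6 * n`.
    have : n + 1 + n ≤ n ^ 3 := by nlinarith [Nat.mul_le_mul hn hn]
    calc n * (n + 1 + n) ^ n * 2 ^ n ≤ n ^ n * (n ^ 3) ^ n * n ^ n := by gcongr
      _ = n ^ (5 * n) := by rw [← pow_mul, ← pow_add, ← pow_add]; congr 1; ring
  have h₂ : n + 1 ≤ 2 ^ n := Nat.lt_two_pow_self
  have h₃ : n ≤ n ^ (5 * n) := Nat.le_self_pow (by omega) n
  have h₄ : 4 ≤ n ^ n := (show 4 = 2 ^ 2 by rfl) ▸ (Nat.pow_le_pow_left hn 2).trans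
    (Nat.pow_le_pow_right (by omega) hn)
  calc (n + 1) + n * 2 ^ (n * (n + 1 + n) ^ n * 2 ^ n)
      ≤ 2 ^ n * 2 ^ n ^ (5 * n) + 2 ^ n * 2 ^ n ^ (5 * n) := by
        gcongr ?_ + ?_
        · exact h₂.trans (Nat.le_mul_of_pos_right _ (by positivity))
        · gcongr <;> omega
    _ = 2 ^ (n + n ^ (5 * n) + 1) := by ring
    _ ≤ 2 ^ n ^ (6 * n) := by
        refine Nat.pow_le_pow_right (by norm_num) ?_
        have : n ^ (6 * n) = n ^ (5 * n) * n ^ n := by rw [← pow_add]; congr 1; ring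
        rw [this]
        nlinarith

theorem rpow_bound_eq {n : ℕ} (hn : 2 ≤ n) :
    (2 : ℝ) ^ ((2 : ℝ) ^ ((6 : ℝ) * (n : ℝ) * Real.logb 2 (n : ℝ))) =
      ((2 ^ n ^ (6 * n) : ℕ) : ℝ) := by
  have : (2 : ℝ) ^ ((6 : ℝ) * (n : ℝ) * Real.logb 2 (n : ℝ)) = ((n ^ (6 * n) : ℕ) : ℝ) := by
    rw [mul_comm, Real.rpow_mul (by norm_num),
      Real.rpow_logb (by norm_num) (by norm_num) (by positivity)]
    rw [show (6 : ℝ) * (n : ℝ) = ((6 * n : ℕ) : ℝ) by push_cast; ring, Real.rpow_natCast]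
    push_cast; rfl
  rw [this, Real.rpow_natCast]
  push_cast; rfl

/-- The finite model property of the Guarded Fragment with a doubly exponential bound. -/
theorem exists_finite_model (φ : Formula) (hφ : φ.IsGFSentence) (hsat : φ.Satisfiable.{u}) :
    ∃ (B : Type u) (_ : Nonempty B) (_ : vocab.Structure B), φ.Models B ∧ Finite B ∧
      (Nat.card B : ℝ) ≤
        (2 : ℝ) ^ ((2 : ℝ) ^ ((6 : ℝ) * (φ.length : ℝ) * Real.logb 2 (φ.length : ℝ))) := by
  classical
  obtain ⟨A, ⟨a₀⟩, _, hA⟩ := hsat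
  by_cases hlen : 2 ≤ φ.length
  · refine ⟨Point a₀ φ.subs φ.vars φ.consts, ⟨.inl ⟨a₀, Finset.mem_insert_self _ _⟩⟩,
      inferInstance, ?_, inferInstance, ?_⟩
    · intro v
      refine (preserved_of_isGuarded hφ.1 (.self φ) ∅ (fun _ _ => 0) (fun _ => a₀) v .empty ?_).2
        (hA _)
      simp [hφ.2]
    · rw [rpow_bound_eq hlen]
      norm_cast
      refine (card_point_le a₀ φ.subs φ.vars φ.consts).trans (le_trans ?_ (numeric_bound hlen))
      have hs := φ.subs_card_le
      have hv := φ.vars_card_le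
      have hc := φ.consts_card_le
      gcongr <;> omega
  -- Below length `2` only `top` and `bot` remain, and a one-point structure satisfies the bound
  -- although the logarithm vanishes.
  · refine ⟨PUnit, inferInstance, ⟨fun _ _ => PUnit.unit, fun _ _ => True⟩, ?_, inferInstance, ?_⟩
    · intro v
      have := hA fun _ => a₀
      cases φ <;> simp only [Formula.length] at hlen <;> try omega
      · trivial
      · exact this
      all_goals
        rename_i ψ
        cases ψ <;> simp [Formula.length] at hlen
    · have : (1 : ℝ) ≤ (2 : ℝ) ^ ((6 : ℝ) * (φ.length : ℝ) * Real.logb 2 (φ.length : ℝ)) := by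
        refine Real.one_le_rpow (by norm_num) ?_
        have : 0 ≤ Real.logb 2 (φ.length : ℝ) := by
          rcases Nat.eq_zero_or_pos φ.length with h | h
          · simp [h]
          · exact Real.logb_nonneg (by norm_num) (by exact_mod_cast h)
        positivity
      simpa using Real.one_le_rpow (x := 2) (by norm_num) (zero_le_one.trans this)

end GuardedFragment

namespace GuardedFragment

/-! ### Sentences with large models

The sentences describe elements `e` that carry a bit for every permutation of a fixed tuple of
distinct elements, and demand that every single bit of every such element can be flipped. -/

section FlipSystem

variable {m : ℕ} {A : Type u}

/-- The transposition which together with `finRotate (m + 2)` generates the symmetric group. -/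
def adjSwap (m : ℕ) : Equiv.Perm (Fin (m + 2)) := Equiv.swap 0 (finRotate (m + 2) 0)

/-- `G e x`: the element `e` carries bits over the tuple `x`; `P e x`: the bit of `e` at `x`;
`H e e' x y`: the bits of `e'` are those of `e` flipped at `x`, as witnessed at `y`. -/
structure FlipSystem (G P : A → (Fin (m + 2) → A) → Prop)
    (H : A → A → (Fin (m + 2) → A) → (Fin (m + 2) → A) → Prop) : Prop where
  nonempty : ∃ e x, G e x
  step : ∀ e x, G e x → x 0 ≠ x 1 ∧ G e (x ∘ finRotate (m + 2)) ∧ G e (x ∘ adjSwap m) ∧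
    ∃ e', H e e' x x
  flip : ∀ e e' x y, H e e' x y → G e' x ∧ H e e' x (y ∘ finRotate (m + 2)) ∧
    H e e' x (y ∘ adjSwap m) ∧ (P e' y ↔ (P e y ↔ ¬ ∀ i, x i = y i))

/-- A property of tuples preserved by the two generators is preserved by all permutations. -/
theorem perm_closed {Q : (Fin (m + 2) → A) → Prop}
    (hrot : ∀ x, Q x → Q (x ∘ finRotate (m + 2))) (hswap : ∀ x, Q x → Q (x ∘ adjSwap m))
    (π : Equiv.Perm (Fin (m + 2))) {x : Fin (m + 2) → A} (hx : Q x) : Q (x ∘ π) := by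
  have hπ : π ∈ Subgroup.closure {finRotate (m + 2), adjSwap m} := by
    have := Equiv.Perm.closure_cycle_adjacent_swap (isCycle_finRotate (n := m)) support_finRotate 0
    rw [adjSwap, this]
    trivial
  induction hπ using Subgroup.closure_induction generalizing x with
  | mem π hπ =>
    rcases hπ with rfl | rfl
    · exact hrot x hx
    · exact hswap x hx
  | one => exact hx
  | mul π ρ _ _ h₁ h₂ => exact h₂ (h₁ hx)
  | inv π _ ih =>
    -- Closure is assumed only in the forward direction, but an inverse of finite order is a
    -- positive or zero power.
    have hpow : ∀ j : ℕ, Q (x ∘ (π ^ j : Equiv.Perm _)) := by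
      intro j
      induction j with
      | zero => exact hx
      | succ j hj => rw [pow_succ]; exact ih hj
    have : π⁻¹ = π ^ (orderOf π - 1) := by
      rw [inv_eq_iff_mul_eq_one, ← pow_succ', Nat.sub_add_cancel (orderOf_pos π), pow_orderOf_eq_one]
    rw [this]
    exact hpow _

namespace FlipSystem

variable {G P : A → (Fin (m + 2) → A) → Prop}
  {H : A → A → (Fin (m + 2) → A) → (Fin (m + 2) → A) → Prop}

theorem perm (h : FlipSystem G P H) {e : A} {x : Fin (m + 2) → A} (hx : G e x)
    (π : Equiv.Perm (Fin (m + 2))) : G e (x ∘ π) :=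
  perm_closed (Q := G e) (fun y hy => (h.step e y hy).2.1) (fun y hy => (h.step e y hy).2.2.1) π hx

/-- Any two distinct positions can be moved to `0` and `1` by a permutation, so the single
inequality in `step` separates all entries. -/
theorem injective (h : FlipSystem G P H) {e : A} {x : Fin (m + 2) → A} (hx : G e x) :
    Function.Injective x := by
  intro i j hij
  by_contra hne
  have h01 : (1 : Fin (m + 2)) ≠ 0 := by simp
  let π := Equiv.swap (0 : Fin (m + 2)) i
  have hπ1 : π 1 ≠ i := by
    rw [← show π 0 = i from Equiv.swap_apply_left _ _]
    exact fun h => h01 (π.injective h)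
  have := (h.step e _ (h.perm hx (Equiv.swap (π 1) j * π))).1
  simp only [Function.comp_apply, Equiv.Perm.mul_apply, Equiv.swap_apply_left] at this
  rw [show π 0 = i from Equiv.swap_apply_left _ _,
    Equiv.swap_apply_of_ne_of_ne hπ1.symm hne] at this
  exact this hij

/-- `H` starts on the diagonal at `x ∘ π`, and closure carries its last argument to every `x ∘ ρ`.
Injectivity of `x` makes the equality test there mean `ρ = π`. -/
theorem exists_flip (h : FlipSystem G P H) {e : A} {x : Fin (m + 2) → A} (hx : G e x)
    (π : Equiv.Perm (Fin (m + 2))) :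
    ∃ e', G e' x ∧ ∀ ρ : Equiv.Perm (Fin (m + 2)), P e' (x ∘ ρ) ↔ (P e (x ∘ ρ) ↔ ρ ≠ π) := by
  obtain ⟨e', he'⟩ := (h.step e _ (h.perm hx π)).2.2.2
  refine ⟨e', ?_, fun ρ => ?_⟩
  · have := h.perm (h.flip _ _ _ _ he').1 π⁻¹
    have hid : (x ∘ π) ∘ (π⁻¹ : Equiv.Perm _) = x := by funext i; simp
    rwa [hid] at this
  · have := perm_closed (Q := H e e' (x ∘ π)) (fun y hy => (h.flip _ _ _ _ hy).2.1)
      (fun y hy => (h.flip _ _ _ _ hy).2.2.1) (π⁻¹ * ρ) he'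
    have hρ : (x ∘ π) ∘ (π⁻¹ * ρ : Equiv.Perm _) = x ∘ ρ := by funext i; simp
    rw [hρ] at this
    rw [(h.flip _ _ _ _ this).2.2.2]
    have : (∀ i, (x ∘ π) i = (x ∘ ρ) i) ↔ ρ = π :=
      ⟨fun hi => Equiv.ext fun i => (h.injective hx (hi i)).symm, fun hi i => by rw [hi]⟩
    rw [this]

/-- Successive flips yield, for each set `T` of permutations, an element differing from `e₀` in
exactly the bits of `T`; its bits recover `T`. -/
theorem two_pow_factorial_le [Finite A] (h : FlipSystem G P H) :
    2 ^ (m + 2).factorial ≤ Nat.card A := by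
  obtain ⟨e₀, x, hx⟩ := h.nonempty
  have key : ∀ T : Finset (Equiv.Perm (Fin (m + 2))), ∃ e, G e x ∧
      ∀ ρ : Equiv.Perm (Fin (m + 2)), P e (x ∘ ρ) ↔ (P e₀ (x ∘ ρ) ↔ ρ ∉ T) := by
    intro T
    induction T using Finset.induction_on with
    | empty => exact ⟨e₀, hx, fun ρ => by simp⟩
    | insert π T hπ ih =>
      obtain ⟨e, he, hP⟩ := ih
      obtain ⟨e', he', hP'⟩ := h.exists_flip he π
      refine ⟨e', he', fun ρ => ?_⟩
      rw [hP', hP, Finset.mem_insert]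
      by_cases hρ : ρ = π
      · subst hρ; tauto
      · tauto
  choose f hf using key
  have hinj : Function.Injective f := by
    intro T T' hTT
    ext ρ
    have h₁ := (hf T).2 ρ
    have h₂ := (hf T').2 ρ
    rw [hTT] at h₁
    tauto
  have := Nat.card_le_card_of_injective f hinj
  simpa [Nat.card_eq_fintype_card, Fintype.card_perm] using this

end FlipSystem

end FlipSystem

/-! ### A guarded sentence for flip systems -/

namespace Formula

/-- An atom all of whose arguments are variables. -/
def varAtom (r : ℕ) {j : ℕ} (z : Fin (j + 1) → ℕ) : Formula :=
  rel (⟨r, j.succ_pos⟩ : vocab.Relations (j + 1)) fun i => .var (z i)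

theorem mem_fv_varAtom {r j : ℕ} {z : Fin (j + 1) → ℕ} {x : ℕ} :
    x ∈ (varAtom r z).fv ↔ x ∈ Set.range z := by
  simp [varAtom, fv, Language.Term.varFinset, eq_comm]

section Sentence

variable (m : ℕ)

/-- The variables of the first tuple. -/
def xVar (i : Fin (m + 2)) : ℕ := 2 * i + 2

/-- The variables of the second tuple. -/
def yVar (i : Fin (m + 2)) : ℕ := 2 * i + 3

variable {m}

/-- The atom `G(e, z)`. -/
def atomG (e : ℕ) (z : Fin (m + 2) → ℕ) : Formula := varAtom 0 (Fin.cons e z : Fin (m + 3) → ℕ)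

/-- The atom `P(e, z)`. -/
def atomP (e : ℕ) (z : Fin (m + 2) → ℕ) : Formula := varAtom 1 (Fin.cons e z : Fin (m + 3) → ℕ)

/-- The arguments of the atom `H(e, e', z, w)`. -/
def quad {α : Type*} (e e' : α) (z w : Fin (m + 2) → α) : Fin (m + 2 + (m + 2) + 1 + 1) → α :=
  Fin.cons e (Fin.cons e' (Fin.append z w : Fin (m + 2 + (m + 2)) → α) :
    Fin (m + 2 + (m + 2) + 1) → α)

/-- The atom `H(e, e', z, w)`. -/
def atomH (e e' : ℕ) (z w : Fin (m + 2) → ℕ) : Formula := varAtom 2 (quad e e' z w)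

variable (m)

/-- The two tuples of variables are equal. -/
def tupleEq : Formula :=
  (List.finRange (m + 2)).foldr (fun i ψ => and (eq (.var (xVar m i)) (.var (yVar m i))) ψ) top

/-- Some element carries bits. -/
def startClause : Formula :=
  exs (0 :: List.ofFn (xVar m)) (and (atomG 0 (xVar m)) top)

/-- The matrix of `stepClause`. -/
def stepBody : Formula :=
  and (not (eq (.var (xVar m 0)) (.var (xVar m 1)))) (and (atomG 0 (xVar m ∘ finRotate (m + 2)))
    (and (atomG 0 (xVar m ∘ adjSwap m)) (exs [1] (and (atomH 0 1 (xVar m) (xVar m)) top))))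

/-- The tuples carrying bits have distinct entries and are closed under permutations, and each bit
can be flipped. -/
def stepClause : Formula :=
  alls (0 :: List.ofFn (xVar m)) (imp (atomG 0 (xVar m)) (stepBody m))

/-- The matrix of `flipClause`. -/
def flipBody : Formula :=
  and (atomG 1 (xVar m)) (and (atomH 0 1 (xVar m) (yVar m ∘ finRotate (m + 2)))
    (and (atomH 0 1 (xVar m) (yVar m ∘ adjSwap m))
      (iff (atomP 1 (yVar m)) (iff (atomP 0 (yVar m)) (not (tupleEq m))))))

/-- The meaning of flipping a bit. -/
def flipClause : Formula :=
  alls (0 :: 1 :: (List.ofFn (xVar m) ++ List.ofFn (yVar m)))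
    (imp (atomH 0 1 (xVar m) (yVar m)) (flipBody m))

/-- The sentence describing flip systems. -/
def flipSentence : Formula := and (startClause m) (and (stepClause m) (flipClause m))

theorem length_tupleEq : (tupleEq m).length = 6 * (m + 2) + 1 := by
  have : ∀ l : List (Fin (m + 2)), (l.foldr (fun i ψ =>
      and (eq (.var (xVar m i)) (.var (yVar m i))) ψ) top).length = 6 * l.length + 1 := by
    intro l
    induction l with
    | nil => rfl
    | cons i l ih => simp only [List.foldr_cons, length, ih, List.length_cons]; ring
  rw [tupleEq, this, List.length_finRange]

/-- Linear growth, possible because closure is stated for two generators only. -/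
theorem length_flipSentence : (flipSentence m).length = 29 * (m + 2) + 108 := by
  simp only [flipSentence, startClause, stepClause, flipClause, stepBody, flipBody, length,
    length_exs, length_alls, length_tupleEq, atomG, atomP, atomH, varAtom, List.length_cons,
    List.length_append, List.length_ofFn, List.length_nil]
  ring

variable {m}

theorem mem_fv_atomG {e : ℕ} {z : Fin (m + 2) → ℕ} {x : ℕ} :
    x ∈ (atomG e z).fv ↔ x = e ∨ ∃ i, z i = x := by
  rw [atomG, mem_fv_varAtom, Fin.range_cons]; rfl

theorem mem_fv_atomP {e : ℕ} {z : Fin (m + 2) → ℕ} {x : ℕ} :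
    x ∈ (atomP e z).fv ↔ x = e ∨ ∃ i, z i = x := by
  rw [atomP, mem_fv_varAtom, Fin.range_cons]; rfl

theorem mem_range_append {α : Type*} {j k : ℕ} {z : Fin j → α} {w : Fin k → α} {a : α} :
    a ∈ Set.range (Fin.append z w) ↔ (∃ i, z i = a) ∨ ∃ i, w i = a := by
  constructor
  · rintro ⟨i, rfl⟩
    induction i using Fin.addCases with
    | left i => exact .inl ⟨i, (Fin.append_left _ _ _).symm⟩
    | right i => exact .inr ⟨i, (Fin.append_right _ _ _).symm⟩
  · rintro (⟨i, rfl⟩ | ⟨i, rfl⟩)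
    · exact ⟨_, Fin.append_left _ _ _⟩
    · exact ⟨_, Fin.append_right _ _ _⟩

theorem mem_fv_atomH {e e' : ℕ} {z w : Fin (m + 2) → ℕ} {x : ℕ} :
    x ∈ (atomH e e' z w).fv ↔ x = e ∨ x = e' ∨ (∃ i, z i = x) ∨ ∃ i, w i = x := by
  rw [atomH, mem_fv_varAtom, quad, Fin.range_cons, Fin.range_cons, Set.mem_insert_iff,
    Set.mem_insert_iff, mem_range_append]

theorem mem_fv_tupleEq {x : ℕ} :
    x ∈ (tupleEq m).fv → (∃ i, xVar m i = x) ∨ ∃ i, yVar m i = x := by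
  have : ∀ l : List (Fin (m + 2)), x ∈ (l.foldr (fun i ψ =>
      and (eq (.var (xVar m i)) (.var (yVar m i))) ψ) top).fv →
        (∃ i, xVar m i = x) ∨ ∃ i, yVar m i = x := by
    intro l
    induction l with
    | nil => simp [fv]
    | cons i l ih =>
      simp only [List.foldr_cons, fv, Language.Term.varFinset, Finset.mem_union,
        Finset.mem_singleton]
      rintro ((rfl | rfl) | h)
      · exact .inl ⟨i, rfl⟩
      · exact .inr ⟨i, rfl⟩
      · exact ih h
  exact this _

theorem isGuarded_tupleEq : (tupleEq m).IsGuarded := by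
  have : ∀ l : List (Fin (m + 2)), (l.foldr (fun i ψ =>
      and (eq (.var (xVar m i)) (.var (yVar m i))) ψ) top).IsGuarded := by
    intro l
    induction l with
    | nil => exact .top
    | cons i l ih => exact .and (.atomic (.eq _ _)) ih
  exact this _

theorem isAtomic_atomG {e : ℕ} {z : Fin (m + 2) → ℕ} : (atomG e z).IsAtomic := .rel _ _

theorem isAtomic_atomP {e : ℕ} {z : Fin (m + 2) → ℕ} : (atomP e z).IsAtomic := .rel _ _

theorem isAtomic_atomH {e e' : ℕ} {z w : Fin (m + 2) → ℕ} : (atomH e e' z w).IsAtomic := .rel _ _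

theorem fv_stepBody : (stepBody m).fv ⊆ (atomG 0 (xVar m)).fv := by
  intro x
  simp only [stepBody, fv, Finset.mem_union, mem_fv_atomG, mem_fv_exs, mem_fv_atomH,
    Language.Term.varFinset, Finset.mem_singleton, Function.comp_apply, List.mem_singleton,
    Finset.notMem_empty]
  rintro ((rfl | rfl) | (h | ⟨i, rfl⟩) | (h | ⟨i, rfl⟩) | h)
  · exact .inr ⟨_, rfl⟩
  · exact .inr ⟨_, rfl⟩
  · exact .inl h
  · exact .inr ⟨_, rfl⟩
  · exact .inl h
  · exact .inr ⟨_, rfl⟩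
  · tauto

theorem fv_flipBody : (flipBody m).fv ⊆ (atomH 0 1 (xVar m) (yVar m)).fv := by
  intro x
  simp only [flipBody, fv, Finset.mem_union, mem_fv_atomG, mem_fv_atomP, mem_fv_atomH,
    Function.comp_apply]
  have h₁ : (∃ i, yVar m (finRotate (m + 2) i) = x) → ∃ i, yVar m i = x := fun ⟨i, hi⟩ => ⟨_, hi⟩
  have h₂ : (∃ i, yVar m (adjSwap m i) = x) → ∃ i, yVar m i = x := fun ⟨i, hi⟩ => ⟨_, hi⟩
  have h₃ := mem_fv_tupleEq (m := m) (x := x)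
  tauto

theorem isGFSentence_flipSentence : (flipSentence m).IsGFSentence := by
  refine ⟨.and ?_ (.and ?_ ?_), ?_⟩
  · refine .ex _ isAtomic_atomG .top (by simp [fv]) fun x hx => ?_
    simpa [mem_fv_atomG, List.mem_ofFn', -List.ofFn_succ] using hx
  · refine .all _ isAtomic_atomG ?_ fv_stepBody fun x hx => ?_
    · refine .and (.not (.atomic (.eq _ _))) (.and (.atomic isAtomic_atomG)
        (.and (.atomic isAtomic_atomG) (.ex _ isAtomic_atomH .top (by simp [fv]) fun x hx => ?_)))
      rw [List.mem_singleton] at hx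
      exact mem_fv_atomH.2 (.inr (.inl hx))
    · simpa [mem_fv_atomG, List.mem_ofFn', -List.ofFn_succ] using hx
  · refine .all _ isAtomic_atomH ?_ fv_flipBody fun x hx => ?_
    · exact .and (.atomic isAtomic_atomG) (.and (.atomic isAtomic_atomH)
        (.and (.atomic isAtomic_atomH) (.iff (.atomic isAtomic_atomP)
          (.iff (.atomic isAtomic_atomP) (.not isGuarded_tupleEq)))))
    · simpa [mem_fv_atomH, List.mem_ofFn', -List.ofFn_succ] using hx
  · refine Finset.eq_empty_of_forall_notMem fun x => ?_
    simp only [flipSentence, startClause, stepClause, flipClause]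
    rw [fv, fv, Finset.mem_union, Finset.mem_union, mem_fv_exs, mem_fv_alls, mem_fv_alls]
    rintro (⟨h, hx⟩ | ⟨h, hx⟩ | ⟨h, hx⟩)
    · refine hx ?_
      simpa [fv, mem_fv_atomG, List.mem_ofFn', -List.ofFn_succ] using h
    · refine hx ?_
      have := (Finset.mem_union.1 h).elim id (fv_stepBody ·)
      simpa [mem_fv_atomG, List.mem_ofFn', -List.ofFn_succ] using this
    · refine hx ?_
      have := (Finset.mem_union.1 h).elim id (fv_flipBody ·)
      simpa [mem_fv_atomH, List.mem_ofFn', -List.ofFn_succ] using this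

variable {A : Type u}

/-- The assignment with prescribed values of the variables of `flipSentence`. -/
def flipAssign (e e' : A) (x y : Fin (m + 2) → A) : ℕ → A
  | 0 => e
  | 1 => e'
  -- Inverts `xVar` and `yVar`: after the shift, parity selects the tuple and the half is the
  -- position. The final `e` is a junk value.
  | n + 2 => if h : n / 2 < m + 2 then (if n % 2 = 0 then x ⟨n / 2, h⟩ else y ⟨n / 2, h⟩) else e

theorem flipAssign_xVar (e e' : A) (x y : Fin (m + 2) → A) :
    flipAssign e e' x y ∘ xVar m = x := by
  funext i
  have h : 2 * i.1 / 2 = i.1 := by omega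
  simp [flipAssign, xVar, h]

theorem flipAssign_yVar (e e' : A) (x y : Fin (m + 2) → A) :
    flipAssign e e' x y ∘ yVar m = y := by
  funext i
  have h : (2 * i.1 + 1) / 2 = i.1 := by omega
  have h' : (2 * i.1 + 1) % 2 = 1 := by omega
  simp [flipAssign, yVar, h, h']

variable (A) [vocab.Structure A]

/-- The interpretation of the relation symbol of `atomG`. -/
def RelG (e : A) (x : Fin (m + 2) → A) : Prop :=
  Language.Structure.RelMap (L := vocab) (⟨0, (m + 2).succ_pos⟩ : vocab.Relations (m + 3))
    (Fin.cons e x : Fin (m + 3) → A)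

/-- The interpretation of the relation symbol of `atomP`. -/
def RelP (e : A) (x : Fin (m + 2) → A) : Prop :=
  Language.Structure.RelMap (L := vocab) (⟨1, (m + 2).succ_pos⟩ : vocab.Relations (m + 3))
    (Fin.cons e x : Fin (m + 3) → A)

/-- The interpretation of the relation symbol of `atomH`. -/
def RelH (e e' : A) (x y : Fin (m + 2) → A) : Prop :=
  Language.Structure.RelMap (L := vocab)
    (⟨2, (m + 2 + (m + 2) + 1).succ_pos⟩ : vocab.Relations (m + 2 + (m + 2) + 1 + 1))
    (quad e e' x y)

variable {A}

theorem comp_quad {α β : Type*} (f : α → β) (e e' : α) (z w : Fin (m + 2) → α) :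
    f ∘ quad e e' z w = quad (f e) (f e') (f ∘ z) (f ∘ w) := by
  rw [quad, quad, Fin.comp_cons, Fin.comp_cons]
  congr 2
  funext i
  induction i using Fin.addCases with
  | left i => rw [Function.comp_apply, Fin.append_left, Fin.append_left]; rfl
  | right i => rw [Function.comp_apply, Fin.append_right, Fin.append_right]; rfl

theorem holds_atomG {e : ℕ} {z : Fin (m + 2) → ℕ} {v : ℕ → A} :
    (atomG e z).Holds v ↔ RelG A (v e) (v ∘ z) := by
  rw [RelG, ← Fin.comp_cons]; rfl

theorem holds_atomP {e : ℕ} {z : Fin (m + 2) → ℕ} {v : ℕ → A} :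
    (atomP e z).Holds v ↔ RelP A (v e) (v ∘ z) := by
  rw [RelP, ← Fin.comp_cons]; rfl

theorem holds_atomH {e e' : ℕ} {z w : Fin (m + 2) → ℕ} {v : ℕ → A} :
    (atomH e e' z w).Holds v ↔ RelH A (v e) (v e') (v ∘ z) (v ∘ w) := by
  rw [RelH, ← comp_quad]; rfl

theorem holds_tupleEq {v : ℕ → A} :
    (tupleEq m).Holds v ↔ ∀ i, v (xVar m i) = v (yVar m i) := by
  have : ∀ l : List (Fin (m + 2)), (l.foldr (fun i ψ =>
      and (eq (.var (xVar m i)) (.var (yVar m i))) ψ) top).Holds v ↔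
        ∀ i ∈ l, v (xVar m i) = v (yVar m i) := by
    intro l
    induction l with
    | nil => simp [Holds]
    | cons i l ih => simp only [List.foldr_cons, Holds, ih, List.forall_mem_cons]; rfl
  simpa [tupleEq] using this (List.finRange (m + 2))

theorem holds_exs_atomH {v : ℕ → A} :
    (exs [1] (and (atomH 0 1 (xVar m) (xVar m)) top)).Holds v ↔
      ∃ e', RelH A (v 0) e' (v ∘ xVar m) (v ∘ xVar m) := by
  refine exists_congr fun a => ?_
  have hx : Function.update v 1 a ∘ xVar m = v ∘ xVar m := by
    funext i
    exact Function.update_of_ne (by simp [xVar]) _ _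
  rw [List.foldr_nil, Holds, holds_atomH, hx]
  simp [Holds]

theorem holds_stepBody {v : ℕ → A} : (stepBody m).Holds v ↔
    v (xVar m 0) ≠ v (xVar m 1) ∧ RelG A (v 0) ((v ∘ xVar m) ∘ finRotate (m + 2)) ∧
      RelG A (v 0) ((v ∘ xVar m) ∘ adjSwap m) ∧
        ∃ e', RelH A (v 0) e' (v ∘ xVar m) (v ∘ xVar m) := by
  rw [stepBody, Holds, Holds, Holds, Holds, Holds, holds_exs_atomH, holds_atomG, holds_atomG]
  rfl

theorem holds_flipBody {v : ℕ → A} : (flipBody m).Holds v ↔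
    RelG A (v 1) (v ∘ xVar m) ∧
      RelH A (v 0) (v 1) (v ∘ xVar m) ((v ∘ yVar m) ∘ finRotate (m + 2)) ∧
      RelH A (v 0) (v 1) (v ∘ xVar m) ((v ∘ yVar m) ∘ adjSwap m) ∧
      (RelP A (v 1) (v ∘ yVar m) ↔ (RelP A (v 0) (v ∘ yVar m) ↔
        ¬ ∀ i, v (xVar m i) = v (yVar m i))) := by
  rw [flipBody, Holds, Holds, Holds, holds_atomG, holds_atomH, holds_atomH, Holds, Holds, Holds,
    holds_atomP, holds_atomP, holds_tupleEq]
  rfl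

theorem models_flipSentence_iff [Nonempty A] :
    (flipSentence m).Models A ↔ FlipSystem (m := m) (RelG A) (RelP A) (RelH A) := by
  constructor
  · intro h
    have hx := flipAssign_xVar (A := A) (m := m)
    have hy := flipAssign_yVar (A := A) (m := m)
    refine ⟨?_, fun e x he => ?_, fun e e' x y he => ?_⟩
    · obtain ⟨w, -, hw, -⟩ := holds_exs.1 (h fun _ => Classical.arbitrary A).1
      exact ⟨_, _, holds_atomG.1 hw⟩
    · let w := flipAssign e e x x
      -- A model satisfies the sentence under every assignment, so `w` itself serves as the outer
      -- assignment.
      have := holds_alls.1 (h w).2.1 w (fun _ _ => rfl)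
        (holds_atomG.2 (by simp only [w, hx]; exact he))
      rw [holds_stepBody] at this
      simp only [w, hx] at this
      have h0 := congrFun (hx e e x x) 0
      have h1 := congrFun (hx e e x x) 1
      simp only [Function.comp_apply] at h0 h1
      rw [h0, h1] at this
      exact this
    · let w := flipAssign e e' x y
      have := holds_alls.1 (h w).2.2 w (fun _ _ => rfl)
        (holds_atomH.2 (by simp only [w, hx, hy]; exact he))
      rw [holds_flipBody] at this
      have h0 := fun i => congrFun (hx e e' x y) i
      have h1 := fun i => congrFun (hy e e' x y) i
      simp only [w, hx, hy] at this
      simp only [Function.comp_apply] at h0 h1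
      simp only [h0, h1] at this
      exact this
  · intro h v
    refine ⟨holds_exs.2 ?_, holds_alls.2 fun w _ hw => ?_, holds_alls.2 fun w _ hw => ?_⟩
    · obtain ⟨e, x, he⟩ := h.nonempty
      refine ⟨fun n => if n ∈ 0 :: List.ofFn (xVar m) then flipAssign e e x x n else v n,
        fun n hn => if_neg hn, holds_atomG.2 ?_, trivial⟩
      have hw : (fun n => if n ∈ 0 :: List.ofFn (xVar m) then flipAssign e e x x n else v n) ∘
          xVar m = x := by
        refine Eq.trans (funext fun i => ?_) (flipAssign_xVar e e x x)
        exact if_pos (List.mem_cons_of_mem _ (List.mem_ofFn.2 ⟨i, rfl⟩))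
      rw [hw, if_pos List.mem_cons_self]
      exact he
    · exact holds_stepBody.2 (h.step _ _ (holds_atomG.1 hw))
    · exact holds_flipBody.2 (h.flip _ _ _ _ (holds_atomH.1 hw))

end Sentence

end Formula

/-! ### A finite flip system -/

section Model

variable (m : ℕ)

/-- The canonical flip system: bit vectors, given as sets of permutations, and the entries of the
tuple. -/
abbrev FlipModel : Type u := ULift.{u} (Finset (Equiv.Perm (Fin (m + 2))) ⊕ Fin (m + 2))

variable {m}

/-- The element given by a set of permutations. -/
def FlipModel.bits (T : Finset (Equiv.Perm (Fin (m + 2)))) : FlipModel.{u} m := ⟨.inl T⟩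

/-- The tuple given by a permutation. -/
def FlipModel.tuple (π : Equiv.Perm (Fin (m + 2))) : Fin (m + 2) → FlipModel.{u} m :=
  fun i => ⟨.inr (π i)⟩

theorem FlipModel.bits_inj {T T' : Finset (Equiv.Perm (Fin (m + 2)))} :
    (bits T : FlipModel.{u} m) = bits T' ↔ T = T' := by
  simp [bits, ULift.ext_iff]

theorem FlipModel.tuple_inj {π ρ : Equiv.Perm (Fin (m + 2))} :
    (tuple π : Fin (m + 2) → FlipModel.{u} m) = tuple ρ ↔ π = ρ := by
  simp [tuple, funext_iff, ULift.ext_iff, Equiv.ext_iff]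

open FlipModel in
instance : vocab.Structure (FlipModel.{u} m) where
  funMap _ _ := bits ∅
  -- Comparing lists fixes the arity of `R` implicitly and avoids casts between `Fin` types.
  RelMap R a :=
    (R.1 = 0 ∧ ∃ T π, List.ofFn a = bits T :: List.ofFn (tuple π)) ∨
    (R.1 = 1 ∧ ∃ T π, List.ofFn a = bits T :: List.ofFn (tuple π) ∧ π ∈ T) ∨
    (R.1 = 2 ∧ ∃ T π ρ, List.ofFn a =
      bits T :: bits (symmDiff T {π}) :: (List.ofFn (tuple π) ++ List.ofFn (tuple ρ)))

namespace FlipModel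

open Formula

theorem relG_iff {e : FlipModel.{u} m} {x : Fin (m + 2) → FlipModel.{u} m} :
    RelG _ e x ↔ ∃ T π, e = bits T ∧ x = tuple π := by
  simp [RelG, Language.Structure.RelMap, -List.ofFn_succ, List.ofFn_cons, List.ofFn_inj]

theorem relP_iff {e : FlipModel.{u} m} {x : Fin (m + 2) → FlipModel.{u} m} :
    RelP _ e x ↔ ∃ T π, e = bits T ∧ x = tuple π ∧ π ∈ T := by
  simp [RelP, Language.Structure.RelMap, -List.ofFn_succ, List.ofFn_cons, List.ofFn_inj, and_assoc]

theorem relH_iff {e e' : FlipModel.{u} m} {x y : Fin (m + 2) → FlipModel.{u} m} :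
    RelH _ e e' x y ↔
      ∃ T π ρ, e = bits T ∧ e' = bits (symmDiff T {π}) ∧ x = tuple π ∧ y = tuple ρ := by
  have : ∀ π ρ, List.ofFn x ++ List.ofFn y = List.ofFn (tuple π) ++ List.ofFn (tuple ρ) ↔
      x = tuple π ∧ y = tuple ρ := fun π ρ => by
    refine ⟨fun h => ?_, fun h => by rw [h.1, h.2]⟩
    have := List.append_inj h (by simp)
    exact ⟨List.ofFn_injective this.1, List.ofFn_injective this.2⟩
  simp [RelH, quad, Language.Structure.RelMap, -List.ofFn_succ, List.ofFn_cons,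
    List.ofFn_fin_append, this]

theorem flipSystem :
    FlipSystem (m := m) (RelG (FlipModel.{u} m)) (RelP (FlipModel.{u} m))
      (RelH (FlipModel.{u} m)) := by
  refine ⟨⟨bits ∅, tuple 1, relG_iff.2 ⟨_, _, rfl, rfl⟩⟩, fun e x h => ?_, fun e e' x y h => ?_⟩
  · obtain ⟨T, π, rfl, rfl⟩ := relG_iff.1 h
    refine ⟨?_, relG_iff.2 ⟨T, π * finRotate (m + 2), rfl, rfl⟩,
      relG_iff.2 ⟨T, π * adjSwap m, rfl, rfl⟩, bits (symmDiff T {π}), ?_⟩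
    · simp [tuple, ULift.ext_iff]
    · exact relH_iff.2 ⟨T, π, π, rfl, rfl, rfl, rfl⟩
  · obtain ⟨T, π, ρ, rfl, rfl, rfl, rfl⟩ := relH_iff.1 h
    refine ⟨relG_iff.2 ⟨_, π, rfl, rfl⟩,
      relH_iff.2 ⟨T, π, ρ * finRotate (m + 2), rfl, rfl, rfl, rfl⟩,
      relH_iff.2 ⟨T, π, ρ * adjSwap m, rfl, rfl, rfl, rfl⟩, ?_⟩
    have hP : ∀ U : Finset (Equiv.Perm (Fin (m + 2))),
        RelP (FlipModel.{u} m) (bits U) (tuple ρ) ↔ ρ ∈ U := fun U => by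
      rw [relP_iff]
      constructor
      · rintro ⟨U', ρ', h₁, h₂, h₃⟩
        rwa [bits_inj.1 h₁, tuple_inj.1 h₂]
      · exact fun h => ⟨U, ρ, rfl, rfl, h⟩
    have heq : (∀ i, (tuple π : Fin (m + 2) → FlipModel.{u} m) i = tuple ρ i) ↔ π = ρ := by
      rw [← funext_iff, tuple_inj]
    rw [hP, hP, heq, Finset.mem_symmDiff, Finset.mem_singleton, eq_comm (a := ρ)]
    tauto

end FlipModel

end Model

/-! ### From factorials to the doubly exponential lower bound -/

theorem pow_self_le_factorial_sq {k : ℕ} (hk : 16 ≤ k) :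
    (k : ℝ) ^ k ≤ (k.factorial : ℝ) ^ 2 := by
  have hf : (0 : ℝ) < k.factorial := by exact_mod_cast k.factorial_pos
  have h16 : (16 : ℝ) ≤ k := by exact_mod_cast hk
  -- The exponential series gives `k ^ k / k! ≤ e ^ k`, and `e < 4`. Squaring costs `16 ^ k`, which
  -- is at most `k ^ k`.
  have h₁ : (k : ℝ) ^ k ≤ 4 ^ k * k.factorial := by
    rw [← div_le_iff₀ hf]
    refine (Real.pow_div_factorial_le_exp _ (by positivity) k).trans ?_
    rw [← mul_one (k : ℝ), Real.exp_nat_mul]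
    have := Real.exp_one_lt_d9
    gcongr
    linarith
  have h₂ : (4 : ℝ) ^ k * 4 ^ k ≤ (k : ℝ) ^ k := by
    rw [← mul_pow]
    gcongr
    linarith
  have hpos : (0 : ℝ) < (k : ℝ) ^ k := by positivity
  refine le_of_mul_le_mul_left ?_ hpos
  calc (k : ℝ) ^ k * (k : ℝ) ^ k ≤ (4 ^ k * k.factorial) * (4 ^ k * k.factorial) := by gcongr
    _ = (4 ^ k * 4 ^ k) * (k.factorial : ℝ) ^ 2 := by ring
    _ ≤ (k : ℝ) ^ k * (k.factorial : ℝ) ^ 2 := by gcongr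

/-- The length is at most `83 k`, its logarithm at most `8 log k`, and `k log k ≤ 2 log k!`; the
product `83 * 8 * 2` stays below `2000`. -/
theorem rpow_length_le_factorial {k : ℕ} (hk : 16 ≤ k) :
    (2 : ℝ) ^ ((1 / 2000 : ℝ) * ((29 * k + 108 : ℕ) : ℝ) *
      Real.logb 2 ((29 * k + 108 : ℕ) : ℝ)) ≤ k.factorial := by
  have hf : (0 : ℝ) < k.factorial := by exact_mod_cast k.factorial_pos
  have h16 : (16 : ℝ) ≤ k := by exact_mod_cast hk
  have hlen : ((29 * k + 108 : ℕ) : ℝ) ≤ 83 * k := by push_cast; linarith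
  have hlog : Real.logb 2 ((29 * k + 108 : ℕ) : ℝ) ≤ 8 * Real.logb 2 k := by
    rw [show (8 : ℝ) * Real.logb 2 k = Real.logb 2 ((k : ℝ) ^ 8) by
      rw [Real.logb_pow]; norm_num]
    refine Real.logb_le_logb_of_le (by norm_num) (by positivity) (hlen.trans ?_)
    have : (83 : ℝ) ≤ (k : ℝ) ^ 7 := le_trans (by norm_num) (pow_le_pow_left₀ (by norm_num) h16 7)
    calc (83 : ℝ) * k ≤ (k : ℝ) ^ 7 * k := by gcongr
      _ = (k : ℝ) ^ 8 := by ring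
  have hk0 : 0 ≤ Real.logb 2 (k : ℝ) := Real.logb_nonneg (by norm_num) (by linarith)
  have hfac : k * Real.logb 2 (k : ℝ) ≤ 2 * Real.logb 2 (k.factorial : ℝ) := by
    have := Real.logb_le_logb_of_le (b := 2) (by norm_num) (by positivity)
      (pow_self_le_factorial_sq hk)
    rwa [Real.logb_pow, Real.logb_pow] at this
  have hfac0 : 0 ≤ Real.logb 2 (k.factorial : ℝ) :=
    Real.logb_nonneg (by norm_num) (by exact_mod_cast k.factorial_pos)
  rw [← Real.le_logb_iff_rpow_le (by norm_num) hf]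
  calc (1 / 2000 : ℝ) * ((29 * k + 108 : ℕ) : ℝ) * Real.logb 2 ((29 * k + 108 : ℕ) : ℝ)
      ≤ (1 / 2000 : ℝ) * (83 * k) * (8 * Real.logb 2 k) := by
        have : 0 ≤ Real.logb 2 ((29 * k + 108 : ℕ) : ℝ) :=
          Real.logb_nonneg (by norm_num) (by push_cast; linarith)
        gcongr
    _ = (664 / 2000) * (k * Real.logb 2 (k : ℝ)) := by ring
    _ ≤ (664 / 2000) * (2 * Real.logb 2 (k.factorial : ℝ)) := by gcongr
    _ ≤ Real.logb 2 (k.factorial : ℝ) := by linarith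

/-- Arbitrarily long sentences of the Guarded Fragment with only doubly exponential models. -/
theorem exists_sentence_with_large_models (n : ℕ) : ∃ φ : Formula,
    φ.IsGFSentence ∧ φ.Satisfiable.{u} ∧ n ≤ φ.length ∧
      ∀ (A : Type u) [Nonempty A] [vocab.Structure A], φ.Models A → Infinite A ∨
        (2 : ℝ) ^ ((2 : ℝ) ^ ((1 / 2000 : ℝ) * (φ.length : ℝ) * Real.logb 2 (φ.length : ℝ))) ≤
          (Nat.card A : ℝ) := by
  -- The shift by `14` makes the tuple length `n + 16`, as the factorial estimate needs at least
  -- `16`.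
  refine ⟨.flipSentence (n + 14), Formula.isGFSentence_flipSentence, ?_, ?_, ?_⟩
  · exact ⟨FlipModel (n + 14), ⟨FlipModel.bits ∅⟩, inferInstance,
      (@Formula.models_flipSentence_iff (n + 14) _ _ ⟨FlipModel.bits ∅⟩).2 FlipModel.flipSystem⟩
  · rw [Formula.length_flipSentence]; omega
  · intro A _ _ hA
    rcases finite_or_infinite A with hfin | hinf
    · right
      have h₁ := (Formula.models_flipSentence_iff.1 hA).two_pow_factorial_le
      rw [Formula.length_flipSentence]
      calc _ ≤ (2 : ℝ) ^ (((n + 14 + 2).factorial : ℕ) : ℝ) :=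
            Real.rpow_le_rpow_of_exponent_le (by norm_num)
              (rpow_length_le_factorial (k := n + 14 + 2) (by omega))
        _ = ((2 ^ (n + 14 + 2).factorial : ℕ) : ℝ) := by rw [Real.rpow_natCast]; push_cast; rfl
        _ ≤ _ := by exact_mod_cast h₁
    · exact .inl hinf

end GuardedFragment

theorem theorem1 :
    ∃ Clb Cub : ℝ, 0 < Clb ∧ Clb < Cub ∧
      (∀ φ : GuardedFragment.Formula, φ.IsGFSentence → φ.Satisfiable.{u} →
        ∃ (B : Type u) (_ : Nonempty B) (_ : GuardedFragment.vocab.Structure B),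
          φ.Models B ∧ Finite B ∧
          (Nat.card B : ℝ) ≤
            (2 : ℝ) ^ ((2 : ℝ) ^ (Cub * (φ.length : ℝ) * Real.logb 2 (φ.length : ℝ)))) ∧
      (∀ n : ℕ, ∃ φ : GuardedFragment.Formula,
        φ.IsGFSentence ∧ φ.Satisfiable.{u} ∧ n ≤ φ.length ∧
        ∀ (A : Type u) [Nonempty A] [GuardedFragment.vocab.Structure A], φ.Models A →
          Infinite A ∨
          (2 : ℝ) ^ ((2 : ℝ) ^ (Clb * (φ.length : ℝ) * Real.logb 2 (φ.length : ℝ))) ≤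
            (Nat.card A : ℝ)) := by
  exact ⟨1 / 2000, 6, by norm_num, by norm_num, GuardedFragment.exists_finite_model,
    GuardedFragment.exists_sentence_with_large_models⟩
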